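/- Let $1<a\le b$ and $M\ge 2$ be constants, and for every $n$ let $m=m_n\in\{2,\dots,M\}$, $\lambda=\lambda_n\in[a,b]$ and $\alpha=\alpha_n\in[0,1]$ (in particular $m$ and $\lambda>1$ may be constants). Put $p=p_n=\lambda\log(n)/n$ (for all $n$ large enough that this is at most $1$). Let $G$ be the directed block model $\mathrm{DBM}(n,m,p,\alpha)$, with law $\mathbb P$: its vertex set is $V=V_1\sqcup\dots\sqcup V_m$ with $V_i=\{x^{(i)}: x\in[n]\}$; independently for every $i\le m$ and every ordered pair $(x,y)\in[n]^2$, an edge from $x^{(i)}$ to $y^{(i)}$ is present with probability $p$; independently, each present edge is rewired with probability $\alpha$, that is, it is replaced by an edge from $x^{(i)}$ to $y^{(j)}$ with $j$ uniform in $[m]\setminus\{i\}$. Write $c(u)$ for the index of the community that contains $u\in V$. Given $G$, let $\mathbf P_x^G$ be the (quenched) law of the simple random walk $(X_s)_{s\ge0}$ on $G$ started at $x\in V$, which at each step moves to a uniformly chosen out-neighbour of its current position (and, by convention, stays put at a vertex without out-neighbours). For $i,j\le m$ and $t\ge0$ let $$Q^t(i,j)=\frac{1+(m\mathbf 1_{i=j}-1)\bigl(1-\frac{m}{m-1}\alpha\bigr)^t}{m}.$$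 Let $t=t_n$ be a sequence of non-negative integers with $t_n\to\infty$ and $t_n=o\bigl(\sqrt n/\log^2 n\bigr)$ as $n\to\infty$. Then $$\max_{i\le m}\ \max_{x\in V}\ \bigl|\mathbf P_x^G(X_{t}\in V_i)-Q^{t}(c(x),i)\bigr|\ \longrightarrow\ 0\quad\text{in }\mathbb P\text{-probability as } n\to\infty,$$ that is, for every $\varepsilon>0$ the $\mathbb P$-probability that the left-hand side exceeds $\varepsilon$ tends to $0$. -/

import Mathlib

open MeasureTheory ProbabilityTheory Filter Topology Asymptotics

/-! ### The simple random walk on a finite digraph -/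

namespace DigraphWalk

variable {V : Type*} [Fintype V]

open Classical in
/-- The set of out-neighbours of `u`. -/
noncomputable def outNbrs (G : Digraph V) (u : V) : Finset V :=
  Finset.univ.filter (fun v => G.Adj u v)

/-- The out-degree `D_u^+`. -/
noncomputable def outDeg (G : Digraph V) (u : V) : ℕ := (outNbrs G u).card

open Classical in
/-- Transition matrix of the simple random walk: from `u` jump to a uniformly chosen out-neighbour.
At a vertex without out-neighbours the walk stays put. -/
noncomputable def transition (G : Digraph V) : Matrix V V ℝ := fun u v =>
  if outDeg G u = 0 then (if u = v then 1 else 0)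
  else if G.Adj u v then 1 / (outDeg G u : ℝ) else 0

open Classical in
/-- The quenched probability `𝐏_x^G(X_t ∈ A)`: the mass that the law at time `t` of the simple
random walk on `G` started at `x` gives to `A`. -/
noncomputable def quenchedProb (G : Digraph V) (x : V) (t : ℕ) (A : Set V) : ℝ :=
  ∑ y : V, if y ∈ A then (transition G ^ t) x y else 0

/-- The transition matrix is stochastic. -/
theorem transition_row_sum (G : Digraph V) (u : V) : ∑ v, transition G u v = 1 := by
  classical
  by_cases h : outDeg G u = 0
  · simp [transition, h]
  · have h' : ((outDeg G u : ℕ) : ℝ) ≠ 0 := by exact_mod_cast h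
    simp only [transition, h, if_false]
    rw [← Finset.sum_filter, Finset.sum_const, nsmul_eq_mul]
    have : (Finset.univ.filter (fun v => G.Adj u v)).card = outDeg G u := by
      unfold outDeg outNbrs
      congr
    rw [this]
    field_simp

end DigraphWalk

/-! ### The directed block model -/

namespace DBM

/-- The vertex `(i, x)` is the vertex with label `x` in the community `V_i`. -/
abbrev Vert (m n : ℕ) : Type := Fin m × Fin n

/-- The community `c(u)` of the vertex `u`. -/
def comm {m n : ℕ} (u : Vert m n) : Fin m := u.1

/-- The vertex set `V_i` of the `i`-th community. -/
def community {m : ℕ} (n : ℕ) (i : Fin m) : Set (Vert m n) := {u | comm u = i}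

/-- The randomness attached to a potential edge, i.e. to an ordered pair of vertices of the same
community: whether the edge is present, the rewiring coin (`true` is a head), and the community
to which the edge points if it is rewired. -/
abbrev EdgeData (m : ℕ) : Type := Bool × Bool × Fin m

/-- A potential edge `((i, x), y)` goes from `(i, x)` to `(i, y)` before the rewiring. -/
abbrev PotEdge (m n : ℕ) : Type := Vert m n × Fin n

/-- Sample space of the model. -/
abbrev Config (m n : ℕ) : Type := PotEdge m n → EdgeData m

/-- Law of the data of one potential edge inside the community `i`: the edge is present with
probability `p`, the coin is a head with probability `α`, and the new community is uniform in
`[m] ∖ {i}`, independently. -/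
noncomputable def edgeLaw {m : ℕ} (p α : unitInterval) (i : Fin m) : Measure (EdgeData m) :=
  (bernoulliMeasure true false p).prod
    ((bernoulliMeasure true false α).prod (uniformOn {j : Fin m | j ≠ i}))

/-- The law `ℙ` of the model: the data of all potential edges are independent. -/
noncomputable def law (m n : ℕ) (p α : unitInterval) : Measure (Config m n) :=
  Measure.pi (fun e : PotEdge m n => edgeLaw p α (comm e.1))

/-- The random digraph `G` after the rewiring. The potential edge from `u` to the vertex with label
`v.2` in the community of `u`, if present, leads in `G` to the vertex with the same label `v.2`, in
the community of `u` if the edge is not rewired, in the community that was drawn if it is. -/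
def graph {m n : ℕ} (ω : Config m n) : Digraph (Vert m n) where
  Adj u v := (ω (u, v.2)).1 = true ∧
    comm v = if (ω (u, v.2)).2.1 = true then (ω (u, v.2)).2.2 else comm u

/-- `Q^t(i, j) = (1 + (m 1_{i=j} - 1) (1 - m α / (m - 1))^t) / m`. -/
noncomputable def Q {m : ℕ} (α : ℝ) (t : ℕ) (i j : Fin m) : ℝ :=
  (1 + ((m : ℝ) * (if i = j then 1 else 0) - 1) * (1 - (m : ℝ) / ((m : ℝ) - 1) * α) ^ t) / (m : ℝ)

/-- `max_{i ≤ m} max_{x ∈ V} |𝐏_x^G(X_t ∈ V_i) - Q^t(c(x), i)|` for the realization `ω`. -/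
noncomputable def maxDev {m n : ℕ} (α : ℝ) (t : ℕ) (ω : Config m n) : ℝ :=
  ⨆ i : Fin m, ⨆ x : Vert m n,
    |DigraphWalk.quenchedProb (graph ω) x t (community n i) - Q α t (comm x) i|

/-- With at least two communities, `ℙ` is a probability measure. -/
theorem isProbabilityMeasure_law (m n : ℕ) (hm : 2 ≤ m) (p α : unitInterval) :
    IsProbabilityMeasure (law m n p α) := by
  have : ∀ i : Fin m, IsProbabilityMeasure (uniformOn {j : Fin m | j ≠ i}) := fun i => by
    have : Nontrivial (Fin m) := Fin.nontrivial_iff_two_le.2 hm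
    exact isProbabilityMeasure_uniformOn (Set.toFinite _) (exists_ne i)
  have : ∀ i : Fin m, IsProbabilityMeasure (edgeLaw p α i) := fun i => by
    unfold edgeLaw
    infer_instance
  unfold law
  infer_instance

end DBM

/-! Only lower bounds on the quenched probabilities are needed: over the communities, both the law
of the walk and `Q` sum to one, so lower bounds with error `c` give two-sided bounds with error `m *
c` (`maxDev_le`).

Most vertices are handled by a second moment. Run two walks from `u` on the same random graph. Under
the annealed law they leave `u` along different edges up to an error of order `1 / (n p)`, and then,
up to an error of order `t ^ 2 / n`, never meet a vertex already visited by either. Along such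
trajectories every step uses fresh edges, so the two communities evolve as independent Markov chains
with kernel `step`, whose powers are `Q` (`pexp_walk_mul_walk_ge`). Hence the quenched probability
concentrates in mean square (`pexp_sq_sub_walk_le`), and with high probability only a small
proportion of vertices is bad. The error `1 / (n p)` is of order `1 / log n`, too large for a union
bound over the starting points.

To reach every `x`, spend one more step at the start: it suffices that few out-edges of `x` lead to
bad vertices. The bad set depends on the out-edges of `x`, so the walk is replaced by the walk
killed at `x`, whose bad set is independent of them. Killing changes little because, simultaneously
for all `x`, a walk from a uniform vertex rarely hits `x`; this follows from a moment of order `log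
n`, obtained by revealing that many walks successively (`pexp_mul_meanHit_pow_le`). Given a sparse
bad set, an exponential Markov bound shows that a fixed positive proportion of the out-edges of `x`
points to it with probability at most `n ^ (-1 - γ)`, since `n p ≥ a log n` with `a > 1`
(`prob_edgesTo_le`, `prob_badOff_le`). This survives the union over `x`.

The first step may be far from typical at some `x`, so its effect on the community must be harmless
(`exists_unlikely`). If `α` is near `0`, the walk nearly always stays in its community; if `m = 2`
and `α` is near `1`, it nearly always switches; the unlikely communities join the bad set. Otherwise
the nontrivial eigenvalue of `step` is bounded away from `±1`, and as `t → ∞` the chain forgets its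
start. -/

/-! ### Expectations with respect to a finite product of finite probability laws -/

set_option linter.unusedSectionVars false

namespace FinProd

variable {ι X : Type*} [Fintype ι] [DecidableEq ι] [Fintype X]

/-- The weights `w i` are probability laws on `X`. -/
structure IsLaw (w : ι → X → ℝ) : Prop where
  nonneg : ∀ i x, 0 ≤ w i x
  sum_eq_one : ∀ i, ∑ x, w i x = 1

/-- Expectation of `F` under the product of the laws `w i`. -/
def pexp (w : ι → X → ℝ) (F : (ι → X) → ℝ) : ℝ := ∑ ω, (∏ i, w i (ω i)) * F ω

variable {w : ι → X → ℝ}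

theorem pexp_prod_apply (s : Finset ι) (hw : IsLaw w) (g : ι → X → ℝ) :
    pexp w (fun ω => ∏ i ∈ s, g i (ω i)) = ∏ i ∈ s, ∑ x, w i x * g i x := by
  classical
  have h1 : ∀ ω : ι → X, (∏ i, w i (ω i)) * ∏ i ∈ s, g i (ω i)
      = ∏ i, w i (ω i) * (if i ∈ s then g i (ω i) else 1) := by
    intro ω
    rw [Finset.prod_mul_distrib, Finset.prod_ite_mem, Finset.univ_inter]
  unfold pexp
  simp_rw [h1]
  have := (Fintype.prod_sum (fun i x => w i x * (if i ∈ s then g i x else 1))).symm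
  rw [this, ← Finset.prod_subset (Finset.subset_univ s)]
  · exact Finset.prod_congr rfl fun i hi => by simp [hi]
  · intro i _ hi
    simp [hi, hw.sum_eq_one]

theorem pexp_const (hw : IsLaw w) (c : ℝ) : pexp w (fun _ => c) = c := by
  have := pexp_prod_apply (w := w) ∅ hw (fun _ _ => 1)
  simp only [Finset.prod_empty, pexp, mul_one] at this
  simp only [pexp, ← Finset.sum_mul, this, one_mul]

theorem weight_nonneg (hw : IsLaw w) (ω : ι → X) : 0 ≤ ∏ i, w i (ω i) :=
  Finset.prod_nonneg fun i _ => hw.nonneg i _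

theorem pexp_mono (hw : IsLaw w) {F G : (ι → X) → ℝ} (h : ∀ ω, F ω ≤ G ω) :
    pexp w F ≤ pexp w G :=
  Finset.sum_le_sum fun ω _ => mul_le_mul_of_nonneg_left (h ω) (weight_nonneg hw ω)

theorem pexp_nonneg (hw : IsLaw w) {F : (ι → X) → ℝ} (h : ∀ ω, 0 ≤ F ω) : 0 ≤ pexp w F :=
  Finset.sum_nonneg fun ω _ => mul_nonneg (weight_nonneg hw ω) (h ω)

theorem pexp_add (F G : (ι → X) → ℝ) : pexp w (fun ω => F ω + G ω) = pexp w F + pexp w G := by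
  simp only [pexp, mul_add, Finset.sum_add_distrib]

theorem pexp_sub (F G : (ι → X) → ℝ) : pexp w (fun ω => F ω - G ω) = pexp w F - pexp w G := by
  simp only [pexp, mul_sub, Finset.sum_sub_distrib]

theorem pexp_mul_const (F : (ι → X) → ℝ) (c : ℝ) :
    pexp w (fun ω => F ω * c) = pexp w F * c := by
  simp only [pexp, Finset.sum_mul, mul_assoc]

theorem pexp_const_mul (c : ℝ) (F : (ι → X) → ℝ) :
    pexp w (fun ω => c * F ω) = c * pexp w F := by
  simp only [pexp, Finset.mul_sum, mul_left_comm]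

theorem pexp_sum {κ : Type*} (s : Finset κ) (F : κ → (ι → X) → ℝ) :
    pexp w (fun ω => ∑ k ∈ s, F k ω) = ∑ k ∈ s, pexp w (F k) := by
  simp only [pexp, Finset.mul_sum]
  exact Finset.sum_comm

theorem pexp_comp_perm (σ : Equiv.Perm ι) (hσ : ∀ i, w (σ i) = w i) (F : (ι → X) → ℝ) :
    pexp w (fun ω => F (fun i => ω (σ i))) = pexp w F := by
  unfold pexp
  rw [← Equiv.sum_comp (Equiv.arrowCongr σ (Equiv.refl X))]
  refine Finset.sum_congr rfl fun ω _ => ?_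
  have : ∏ i, w i ((Equiv.arrowCongr σ (Equiv.refl X)) ω i) = ∏ i, w i (ω i) := by
    rw [← Equiv.prod_comp σ]
    exact Finset.prod_congr rfl fun i _ => by simp [hσ]
  rw [this]
  simp

/-- Functions of disjoint sets of coordinates are uncorrelated. -/
theorem pexp_mul_of_dependsOn (hw : IsLaw w) {A B : (ι → X) → ℝ} {s : Set ι}
    (hA : DependsOn A s) (hB : DependsOn B sᶜ) :
    pexp w (fun ω => A ω * B ω) = pexp w A * pexp w B := by
  classical
  let mix : (ι → X) → (ι → X) → ι → X := fun ω ω' i => if i ∈ s then ω i else ω' i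
  -- `Φ` exchanges the coordinates outside `s` between two independent copies. It preserves the
  -- product weight and turns `A ω * B ω` into `A ω * B ω'`.
  let Φ : ((ι → X) × (ι → X)) ≃ ((ι → X) × (ι → X)) :=
    { toFun := fun q => (mix q.1 q.2, mix q.2 q.1)
      invFun := fun q => (mix q.1 q.2, mix q.2 q.1)
      left_inv := fun q => by
        ext i <;> by_cases h : i ∈ s <;> simp [mix, h]
      right_inv := fun q => by
        ext i <;> by_cases h : i ∈ s <;> simp [mix, h] }
  let W : (ι → X) → ℝ := fun ω => ∏ i, w i (ω i)
  have hW : ∀ q, W (Φ q).1 * W (Φ q).2 = W q.1 * W q.2 := by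
    intro q
    simp only [W, ← Finset.prod_mul_distrib]
    refine Finset.prod_congr rfl fun i _ => ?_
    by_cases h : i ∈ s <;> simp [Φ, mix, h, mul_comm]
  have e1 : pexp w (fun ω => A ω * B ω)
      = ∑ q : (ι → X) × (ι → X), W q.1 * W q.2 * (A q.1 * B q.1) := by
    have h1 : ∑ ω, W ω = 1 := by
      have := pexp_const hw 1
      simpa [pexp] using this
    rw [Fintype.sum_prod_type]
    refine Finset.sum_congr rfl fun ω _ => ?_
    calc (∏ i, w i (ω i)) * (A ω * B ω) = (W ω * (A ω * B ω)) * ∑ ω', W ω' := by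
          rw [h1, mul_one]
      _ = _ := by
          rw [Finset.mul_sum]
          exact Finset.sum_congr rfl fun ω' _ => by ring
  have e2 : pexp w A * pexp w B
      = ∑ q : (ι → X) × (ι → X), W q.1 * W q.2 * (A q.1 * B q.2) := by
    rw [Fintype.sum_prod_type]
    unfold pexp
    rw [Finset.sum_mul_sum]
    refine Finset.sum_congr rfl fun ω _ => Finset.sum_congr rfl fun ω' _ => ?_
    simp only [W]
    ring
  rw [e1, e2, ← Equiv.sum_comp Φ]
  refine Finset.sum_congr rfl fun q _ => ?_
  rw [hW]
  have hA' : A (Φ q).1 = A q.1 := hA fun i hi => by simp [Φ, mix, hi]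
  have hB' : B (Φ q).1 = B q.2 := hB fun i hi => by
    have : i ∉ s := hi
    simp [Φ, mix, this]
  rw [hA', hB']

theorem pexp_mul_of_dependsOn_of_disjoint (hw : IsLaw w) {A B : (ι → X) → ℝ} {s t : Set ι}
    (hA : DependsOn A s) (hB : DependsOn B t) (hst : Disjoint s t) :
    pexp w (fun ω => A ω * B ω) = pexp w A * pexp w B :=
  pexp_mul_of_dependsOn hw hA fun _ _ h => hB fun i hi => h i (hst.symm.subset_compl_right hi)

open Classical in
/-- Probability of an event. -/
noncomputable def prob (w : ι → X → ℝ) (S : Set (ι → X)) : ℝ :=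
  pexp w (fun ω => if ω ∈ S then 1 else 0)

theorem prob_le_pexp (hw : IsLaw w) {S : Set (ι → X)} {F : (ι → X) → ℝ} (h0 : ∀ ω, 0 ≤ F ω)
    (h : ∀ ω ∈ S, 1 ≤ F ω) : prob w S ≤ pexp w F := by
  refine pexp_mono hw fun ω => ?_
  split_ifs with hω
  · exact h ω hω
  · exact h0 ω

theorem prob_mono (hw : IsLaw w) {S T : Set (ι → X)} (h : S ⊆ T) : prob w S ≤ prob w T := by
  refine pexp_mono hw fun ω => ?_
  split_ifs with h1 h2 h2
  · exact le_rfl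
  · exact absurd (h h1) h2
  · exact zero_le_one
  · exact le_rfl

theorem prob_union_le (hw : IsLaw w) (S T : Set (ι → X)) :
    prob w (S ∪ T) ≤ prob w S + prob w T := by
  unfold prob
  rw [← pexp_add]
  refine pexp_mono hw fun ω => ?_
  by_cases h1 : ω ∈ S <;> by_cases h2 : ω ∈ T <;> simp [h1, h2]

theorem prob_iUnion_le (hw : IsLaw w) {κ : Type*} [Fintype κ] (S : κ → Set (ι → X)) :
    prob w (⋃ k, S k) ≤ ∑ k, prob w (S k) := by
  classical
  unfold prob
  rw [← pexp_sum]
  refine pexp_mono hw fun ω => ?_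
  split_ifs with h
  · obtain ⟨k, hk⟩ := Set.mem_iUnion.1 h
    calc (1 : ℝ) = if ω ∈ S k then 1 else 0 := by simp [hk]
      _ ≤ _ := Finset.single_le_sum (f := fun k => if ω ∈ S k then (1 : ℝ) else 0)
          (fun k _ => by split_ifs <;> norm_num) (Finset.mem_univ k)
  · exact Finset.sum_nonneg fun k _ => by split_ifs <;> norm_num

theorem prob_le_div (hw : IsLaw w) {F : (ι → X) → ℝ} (h0 : ∀ ω, 0 ≤ F ω) {c : ℝ} (hc : 0 < c) :
    prob w {ω | c ≤ F ω} ≤ pexp w F / c := by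
  rw [div_eq_mul_inv, ← pexp_mul_const]
  refine prob_le_pexp hw (fun ω => mul_nonneg (h0 ω) (inv_nonneg.2 hc.le)) fun ω hω => ?_
  rw [← div_eq_mul_inv, one_le_div hc]
  exact hω

/-- The product measure gives to a set the sum of the weights of its points. -/
theorem measureReal_pi_eq_prob [MeasurableSpace X] [MeasurableSingletonClass X]
    (μ : ι → Measure X) [∀ i, IsProbabilityMeasure (μ i)] (S : Set (ι → X)) :
    (Measure.pi μ).real S = prob (fun i x => (μ i).real {x}) S := by
  classical
  have hS : S = ((Finset.univ.filter (fun ω => ω ∈ S) : Finset (ι → X)) : Set (ι → X)) := by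
    ext; simp
  conv_lhs => rw [hS]
  rw [← sum_measureReal_singleton]
  unfold prob pexp
  rw [Finset.sum_filter]
  refine Finset.sum_congr rfl fun ω _ => ?_
  split_ifs
  · rename_i h
    simp only [if_pos h, mul_one]
    rw [measureReal_def, Measure.pi_singleton, ENNReal.toReal_prod]
    rfl
  · rename_i h
    simp only [if_neg h, mul_zero]

theorem isLaw_measureReal [MeasurableSpace X] [MeasurableSingletonClass X]
    (μ : ι → Measure X) [∀ i, IsProbabilityMeasure (μ i)] :
    IsLaw (fun i x => (μ i).real {x}) where
  nonneg _ _ := measureReal_nonneg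
  sum_eq_one i := by
    rw [sum_measureReal_singleton]
    simp

end FinProd

/-! ### The law of one potential edge -/

namespace DBM

open FinProd

variable {m n : ℕ} {p α : unitInterval}

/-- One-step law of the community process. -/
noncomputable def step (α : ℝ) (i j : Fin m) : ℝ :=
  if j = i then 1 - α else α / ((m : ℝ) - 1)

/-- The community to which an edge with data `d` and source community `i` points. -/
def target (i : Fin m) (d : EdgeData m) : Fin m := if d.2.1 = true then d.2.2 else i

/-- The law of the data of a potential edge, as a weight. -/
noncomputable def edgeWeight (m n : ℕ) (p α : unitInterval) (e : PotEdge m n) (d : EdgeData m) :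
    ℝ := (edgeLaw p α (comm e.1)).real {d}

theorem isProbabilityMeasure_edgeLaw (hm : 2 ≤ m) (i : Fin m) :
    IsProbabilityMeasure (edgeLaw p α i) := by
  have : IsProbabilityMeasure (uniformOn {j : Fin m | j ≠ i}) := by
    have : Nontrivial (Fin m) := Fin.nontrivial_iff_two_le.2 hm
    exact isProbabilityMeasure_uniformOn (Set.toFinite _) (exists_ne i)
  unfold edgeLaw
  infer_instance

theorem isLaw_edgeWeight (hm : 2 ≤ m) : IsLaw (edgeWeight m n p α) := by
  have := isProbabilityMeasure_edgeLaw (p := p) (α := α) hm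
  exact isLaw_measureReal (fun e : PotEdge m n => edgeLaw p α (comm e.1))

theorem law_real_eq_prob (hm : 2 ≤ m) (S : Set (Config m n)) :
    (law m n p α).real S = prob (edgeWeight m n p α) S := by
  have := isProbabilityMeasure_edgeLaw (p := p) (α := α) hm
  exact measureReal_pi_eq_prob (fun e : PotEdge m n => edgeLaw p α (comm e.1)) S

theorem uniformOn_real_singleton (hm : 2 ≤ m) (i j : Fin m) :
    (uniformOn {j : Fin m | j ≠ i}).real {j} = if j = i then 0 else 1 / ((m : ℝ) - 1) := by
  have h : ({j : Fin m | j ≠ i} : Set (Fin m)) = ((Finset.univ.erase i : Finset (Fin m)) : Set _) := by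
    ext; simp
  have h2 : ({j} : Set (Fin m)) = (({j} : Finset (Fin m)) : Set _) := by simp
  rw [measureReal_def, h, h2, uniformOn_apply_finset]
  rw [Finset.card_erase_of_mem (Finset.mem_univ i), Finset.card_univ, Fintype.card_fin]
  split_ifs with hij
  · subst hij; simp
  · have : (Finset.univ.erase i) ∩ {j} = {j} := by
      rw [Finset.inter_singleton_of_mem]
      simp [hij]
    rw [this, Finset.card_singleton]
    have : ((m - 1 : ℕ) : ℝ) = (m : ℝ) - 1 := by
      rw [Nat.cast_sub (by omega)]; simp
    simp only [ENNReal.toReal_div, ENNReal.toReal_natCast, Nat.cast_one, this, ENNReal.toReal_one]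

theorem edgeWeight_apply (hm : 2 ≤ m) (e : PotEdge m n) (a b : Bool) (j : Fin m) :
    edgeWeight m n p α e (a, b, j) = (if a = true then (p : ℝ) else 1 - p) *
      ((if b = true then (α : ℝ) else 1 - α) *
        (if j = comm e.1 then 0 else 1 / ((m : ℝ) - 1))) := by
  unfold edgeWeight edgeLaw
  rw [← Set.singleton_prod_singleton, measureReal_prod_prod, ← Set.singleton_prod_singleton,
    measureReal_prod_prod, uniformOn_real_singleton hm]
  congr 2
  · cases a <;> simp
  · cases b <;> simp

theorem sum_step_mul (α : ℝ) (i : Fin m) (g : Fin m → ℝ) :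
    ∑ j, step α i j * g j
      = (1 - α) * g i + α * ∑ j, (if j = i then 0 else 1 / ((m : ℝ) - 1)) * g j := by
  rw [← Finset.add_sum_erase _ _ (Finset.mem_univ i),
    ← Finset.add_sum_erase _ (fun j => (if j = i then 0 else 1 / ((m : ℝ) - 1)) * g j)
      (Finset.mem_univ i)]
  simp only [step, if_true, zero_mul, zero_add]
  rw [Finset.mul_sum]
  congr 1
  refine Finset.sum_congr rfl fun j hj => ?_
  rw [if_neg (Finset.ne_of_mem_erase hj), if_neg (Finset.ne_of_mem_erase hj)]
  ring

theorem sum_unif (hm : 2 ≤ m) (i : Fin m) :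
    ∑ j : Fin m, (if j = i then (0 : ℝ) else 1 / ((m : ℝ) - 1)) = 1 := by
  have h : (2 : ℝ) ≤ m := by exact_mod_cast hm
  rw [Finset.sum_ite, Finset.sum_const_zero, zero_add, Finset.sum_const,
    Finset.filter_not, Finset.filter_eq', if_pos (Finset.mem_univ i), Finset.card_sdiff]
  simp only [Finset.inter_univ, Finset.card_singleton, Finset.card_univ, Fintype.card_fin,
    nsmul_eq_mul]
  rw [Nat.cast_sub (by omega)]
  field_simp
  push_cast
  rw [div_self (by linarith)]

theorem sum_step (hm : 2 ≤ m) (α : ℝ) (i : Fin m) : ∑ j, step α i j = 1 := by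
  have := sum_step_mul α i (fun _ => 1)
  simp only [mul_one, sum_unif hm] at this
  rw [this]; ring

theorem step_nonneg (hm : 2 ≤ m) {α : ℝ} (h0 : 0 ≤ α) (h1 : α ≤ 1) (i j : Fin m) :
    0 ≤ step α i j := by
  have h : (2 : ℝ) ≤ m := by exact_mod_cast hm
  unfold step
  split_ifs
  · linarith
  · exact div_nonneg h0 (by linarith)

theorem step_le_one (hm : 2 ≤ m) {α : ℝ} (h0 : 0 ≤ α) (h1 : α ≤ 1) (i j : Fin m) :
    step α i j ≤ 1 := by
  rw [← sum_step hm α i]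
  exact Finset.single_le_sum (fun j _ => step_nonneg hm h0 h1 i j) (Finset.mem_univ j)

/-- Expectation of a function of one potential edge. -/
theorem sum_edgeWeight_mul (hm : 2 ≤ m) (e : PotEdge m n) (g : Fin m → ℝ) (r : ℝ) :
    ∑ d, edgeWeight m n p α e d * (if d.1 = true then g (target (comm e.1) d) else r)
      = (1 - p) * r + p * ∑ j, step α (comm e.1) j * g j := by
  have hu := sum_unif hm (comm e.1)
  rw [sum_step_mul]
  simp only [Fintype.sum_prod_type, Fintype.sum_bool, edgeWeight_apply hm, target, if_true,
    Bool.false_eq_true, if_false]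
  simp only [mul_assoc]
  simp only [← Finset.mul_sum, ← Finset.sum_mul, hu]
  ring

end DBM

/-! ### Out-edges of one vertex -/

namespace DBM

open FinProd DigraphWalk

variable {m n : ℕ} {p α : unitInterval}

/-- The value `g` at the target community if the edge is present, `0` otherwise. -/
def edgeVal (ω : Config m n) (u : Vert m n) (g : Fin m → ℝ) (l : Fin n) : ℝ :=
  if (ω (u, l)).1 = true then g (target (comm u) (ω (u, l))) else 0

/-- Indicator that the potential edge from `u` to the label `l` is present. -/
def pres (ω : Config m n) (u : Vert m n) (l : Fin n) : ℝ :=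
  if (ω (u, l)).1 = true then 1 else 0

/-- The out-degree as a sum of indicators. -/
def deg (ω : Config m n) (u : Vert m n) : ℝ := ∑ l, pres ω u l

theorem edgeVal_one (ω : Config m n) (u : Vert m n) (l : Fin n) :
    edgeVal ω u (fun _ => 1) l = pres ω u l := rfl

theorem pres_nonneg (ω : Config m n) (u : Vert m n) (l : Fin n) : 0 ≤ pres ω u l := by
  unfold pres; split_ifs <;> norm_num

theorem pres_mul_self (ω : Config m n) (u : Vert m n) (l : Fin n) :
    pres ω u l * pres ω u l = pres ω u l := by
  unfold pres; split_ifs <;> norm_num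

theorem deg_nonneg (ω : Config m n) (u : Vert m n) : 0 ≤ deg ω u :=
  Finset.sum_nonneg fun _ _ => pres_nonneg _ _ _

theorem adj_iff (ω : Config m n) (u : Vert m n) (j : Fin m) (l : Fin n) :
    (graph ω).Adj u (j, l) ↔ (ω (u, l)).1 = true ∧ j = target (comm u) (ω (u, l)) := Iff.rfl

open Classical in
theorem sum_adj_mul (ω : Config m n) (u : Vert m n) (g : Vert m n → ℝ) :
    ∑ v, (if (graph ω).Adj u v then g v else 0)
      = ∑ l, (if (ω (u, l)).1 = true then g (target (comm u) (ω (u, l)), l) else 0) := by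
  rw [Fintype.sum_prod_type_right]
  refine Finset.sum_congr rfl fun l _ => ?_
  simp only [adj_iff]
  by_cases h : (ω (u, l)).1 = true
  · simp [h]
  · simp [h]

theorem outDeg_eq (ω : Config m n) (u : Vert m n) : (outDeg (graph ω) u : ℝ) = deg ω u := by
  classical
  have := sum_adj_mul ω u (fun _ => 1)
  rw [← Finset.sum_filter, Finset.sum_const, nsmul_eq_mul, mul_one] at this
  unfold outDeg outNbrs deg pres
  rw [← this]

theorem outDeg_eq_zero_iff (ω : Config m n) (u : Vert m n) :
    outDeg (graph ω) u = 0 ↔ deg ω u = 0 := by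
  rw [← outDeg_eq]; simp

theorem transition_nonneg {V : Type*} [Fintype V] (G : Digraph V) (u v : V) :
    0 ≤ transition G u v := by
  unfold transition
  split_ifs <;> positivity

/-- Since `0⁻¹ = 0`, the second term vanishes at a vertex without out-neighbours and only the
convention of staying put remains. -/
theorem transition_eq (ω : Config m n) (u v : Vert m n) :
    transition (graph ω) u v = (if deg ω u = 0 then (if u = v then 1 else 0) else 0)
      + edgeVal ω u (fun j => if j = v.1 then 1 else 0) v.2 * (deg ω u)⁻¹ := by
  classical
  obtain ⟨j, l⟩ := v
  unfold transition
  simp only [outDeg_eq_zero_iff, outDeg_eq]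
  by_cases h1 : deg ω u = 0
  · simp [h1]
  · simp only [h1, if_false, zero_add, adj_iff, edgeVal]
    by_cases h4 : (ω (u, l)).1 = true <;> by_cases h5 : j = target (comm u) (ω (u, l)) <;>
      simp [h4, h5, eq_comm]

/-- The action of the transition matrix on functions. -/
theorem sum_transition_mul (ω : Config m n) (u : Vert m n) (g : Vert m n → ℝ) :
    ∑ v, transition (graph ω) u v * g v = (if deg ω u = 0 then g u else 0)
      + (∑ l, edgeVal ω u (fun j => g (j, l)) l) * (deg ω u)⁻¹ := by
  classical
  unfold transition
  simp only [outDeg_eq_zero_iff, outDeg_eq]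
  split_ifs with h
  · simp [h]
  · have := sum_adj_mul ω u g
    unfold edgeVal
    rw [← this, Finset.sum_mul, zero_add]
    refine Finset.sum_congr rfl fun v _ => ?_
    split_ifs <;> simp [mul_comm]

theorem sum_edgeVal_le (ω : Config m n) (u : Vert m n) {g : Vert m n → ℝ} (hg : ∀ v, 0 ≤ g v) :
    ∑ l, edgeVal ω u (fun j => g (j, l)) l * (deg ω u)⁻¹
      ≤ ∑ v, transition (graph ω) u v * g v := by
  rw [sum_transition_mul, Finset.sum_mul]
  have : 0 ≤ if deg ω u = 0 then g u else 0 := by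
    split_ifs
    · exact hg u
    · exact le_rfl
  linarith

/-- The potential edges with source in `S`. -/
def rows (S : Set (Vert m n)) : Set (PotEdge m n) := {e | e.1 ∈ S}

theorem pres_congr {ω ω' : Config m n} {u : Vert m n} {l : Fin n} (h : ω (u, l) = ω' (u, l)) :
    pres ω u l = pres ω' u l := by
  unfold pres; rw [h]

theorem deg_congr {ω ω' : Config m n} {u : Vert m n} (h : ∀ l, ω (u, l) = ω' (u, l)) :
    deg ω u = deg ω' u :=
  Finset.sum_congr rfl fun l _ => pres_congr (h l)

theorem transition_congr {ω ω' : Config m n} {u : Vert m n} (h : ∀ l, ω (u, l) = ω' (u, l))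
    (v : Vert m n) : transition (graph ω) u v = transition (graph ω') u v := by
  rw [transition_eq, transition_eq, deg_congr h]
  unfold edgeVal
  rw [h]

theorem dependsOn_transition (u v : Vert m n) :
    DependsOn (fun ω : Config m n => transition (graph ω) u v) (rows {u}) :=
  fun _ _ h => transition_congr (fun l => h (u, l) rfl) v

/-- Number of edges from `u` to labels outside `A`. -/
def degOff (ω : Config m n) (u : Vert m n) (A : Finset (Fin n)) : ℝ := ∑ l ∈ Aᶜ, pres ω u l

theorem degOff_nonneg (ω : Config m n) (u : Vert m n) (A : Finset (Fin n)) :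
    0 ≤ degOff ω u A := Finset.sum_nonneg fun _ _ => pres_nonneg _ _ _

theorem deg_eq_sum_add (ω : Config m n) (u : Vert m n) (A : Finset (Fin n)) :
    deg ω u = ∑ l ∈ A, pres ω u l + degOff ω u A :=
  (Finset.sum_add_sum_compl A _).symm

/-- If the edge is absent both sides vanish; if it is present the degree is one plus the number of
other edges. The right-hand side is a product of functions of disjoint coordinates, which makes
expectations with a random degree in the denominator tractable. -/
theorem edgeVal_mul_inv_deg (ω : Config m n) (u : Vert m n) (g : Fin m → ℝ) (l : Fin n) :
    edgeVal ω u g l * (deg ω u)⁻¹ = edgeVal ω u g l * (1 + degOff ω u {l})⁻¹ := by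
  rw [deg_eq_sum_add ω u {l}, Finset.sum_singleton]
  unfold edgeVal pres
  split_ifs <;> simp

theorem edgeVal_mul_edgeVal_mul_inv_deg (ω : Config m n) (u : Vert m n) (g g' : Fin m → ℝ)
    {l l' : Fin n} (hl : l ≠ l') :
    edgeVal ω u g l * edgeVal ω u g' l' * ((deg ω u)⁻¹ * (deg ω u)⁻¹)
      = edgeVal ω u g l * (edgeVal ω u g' l' *
        ((2 + degOff ω u {l, l'})⁻¹ * (2 + degOff ω u {l, l'})⁻¹)) := by
  rw [deg_eq_sum_add ω u {l, l'}, Finset.sum_pair hl]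
  unfold edgeVal pres
  split_ifs
  · norm_num; ring
  · simp
  · simp
  · simp

theorem dependsOn_degOff (u : Vert m n) (A : Finset (Fin n)) :
    DependsOn (fun ω : Config m n => degOff ω u A) {e | e.2 ∉ A} :=
  fun _ _ h => Finset.sum_congr rfl fun l hl => pres_congr (h (u, l) (by simpa using hl))

theorem dependsOn_edgeVal (u : Vert m n) (g : Fin m → ℝ) (l : Fin n) :
    DependsOn (fun ω : Config m n => edgeVal ω u g l) {(u, l)} := fun _ _ h => by
  simp only [edgeVal]
  rw [h (u, l) rfl]

theorem pexp_edgeVal (hm : 2 ≤ m) (u : Vert m n) (g : Fin m → ℝ) (l : Fin n) :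
    pexp (edgeWeight m n p α) (fun ω => edgeVal ω u g l) = p * ∑ j, step α (comm u) j * g j := by
  have h := pexp_prod_apply {((u, l) : PotEdge m n)} (isLaw_edgeWeight (p := p) (α := α) hm)
    (fun e d => if d.1 = true then g (target (comm e.1) d) else 0)
  simp only [Finset.prod_singleton] at h
  rw [sum_edgeWeight_mul hm] at h
  simpa [edgeVal] using h

theorem pexp_edgeVal_mul_inv (hm : 2 ≤ m) (u : Vert m n) (g : Fin m → ℝ) (l : Fin n) :
    pexp (edgeWeight m n p α) (fun ω => edgeVal ω u g l * (deg ω u)⁻¹)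
      = (p * ∑ j, step α (comm u) j * g j) *
        pexp (edgeWeight m n p α) (fun ω => (1 + degOff ω u {l})⁻¹) := by
  simp_rw [edgeVal_mul_inv_deg]
  rw [pexp_mul_of_dependsOn_of_disjoint (isLaw_edgeWeight hm) (dependsOn_edgeVal u g l)
    (B := fun ω => (1 + degOff ω u {l})⁻¹) (t := {e | e.2 ∉ ({l} : Finset (Fin n))}),
    pexp_edgeVal hm]
  · exact fun _ _ h => by
      have := dependsOn_degOff u {l} h
      simp only at this ⊢
      rw [this]
  · simp

theorem pexp_pres_mul_inv (hm : 2 ≤ m) (u : Vert m n) (l : Fin n) :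
    pexp (edgeWeight m n p α) (fun ω => pres ω u l * (deg ω u)⁻¹)
      = p * pexp (edgeWeight m n p α) (fun ω => (1 + degOff ω u {l})⁻¹) := by
  have := pexp_edgeVal_mul_inv (p := p) (α := α) hm u (fun _ => 1) l
  simpa [edgeVal_one, sum_step hm] using this

/-- The target community is independent of the presence of all the edges, hence of the degree, so
its mean factors out exactly. -/
theorem pexp_edgeVal_mul_inv' (hm : 2 ≤ m) (u : Vert m n) (g : Fin m → ℝ) (l : Fin n) :
    pexp (edgeWeight m n p α) (fun ω => edgeVal ω u g l * (deg ω u)⁻¹)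
      = (∑ j, step α (comm u) j * g j) *
        pexp (edgeWeight m n p α) (fun ω => pres ω u l * (deg ω u)⁻¹) := by
  rw [pexp_edgeVal_mul_inv hm, pexp_pres_mul_inv hm]; ring

theorem pexp_pair_aux (hm : 2 ≤ m) (u : Vert m n) (g g' : Fin m → ℝ) {l l' : Fin n}
    (hl : l ≠ l') :
    pexp (edgeWeight m n p α)
        (fun ω => edgeVal ω u g l * edgeVal ω u g' l' * ((deg ω u)⁻¹ * (deg ω u)⁻¹))
      = (p * ∑ j, step α (comm u) j * g j) * ((p * ∑ j, step α (comm u) j * g' j) *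
        pexp (edgeWeight m n p α)
          (fun ω => (2 + degOff ω u {l, l'})⁻¹ * (2 + degOff ω u {l, l'})⁻¹)) := by
  have h1 : DependsOn (fun ω : Config m n =>
      (2 + degOff ω u {l, l'})⁻¹ * (2 + degOff ω u {l, l'})⁻¹)
      {e | e.2 ∉ ({l, l'} : Finset (Fin n))} := fun _ _ h => by
    have := dependsOn_degOff u {l, l'} h
    simp only at this ⊢
    rw [this]
  simp_rw [edgeVal_mul_edgeVal_mul_inv_deg _ u g g' hl]
  rw [pexp_mul_of_dependsOn_of_disjoint (isLaw_edgeWeight hm) (dependsOn_edgeVal u g l)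
    (B := fun ω => edgeVal ω u g' l' *
        ((2 + degOff ω u {l, l'})⁻¹ * (2 + degOff ω u {l, l'})⁻¹)) (t := {e | e.2 ≠ l}),
    pexp_mul_of_dependsOn_of_disjoint (isLaw_edgeWeight hm) (dependsOn_edgeVal u g' l') h1,
    pexp_edgeVal hm, pexp_edgeVal hm]
  · simp
  · intro x y h
    have a1 := dependsOn_edgeVal u g' l' (x := x) (y := y) fun e he => h e (by
      rw [Set.mem_singleton_iff] at he
      subst he
      exact hl.symm)
    have a2 := h1 (x := x) (y := y) fun e he => h e (by
      intro h'
      simp [h'] at he)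
    simp only at a1 a2 ⊢
    rw [a1, a2]
  · simp

theorem pexp_pair (hm : 2 ≤ m) (u : Vert m n) (g g' : Fin m → ℝ) {l l' : Fin n} (hl : l ≠ l') :
    pexp (edgeWeight m n p α)
        (fun ω => edgeVal ω u g l * edgeVal ω u g' l' * ((deg ω u)⁻¹ * (deg ω u)⁻¹))
      = (∑ j, step α (comm u) j * g j) * (∑ j, step α (comm u) j * g' j) *
        pexp (edgeWeight m n p α)
          (fun ω => pres ω u l * pres ω u l' * ((deg ω u)⁻¹ * (deg ω u)⁻¹)) := by
  have h1 := pexp_pair_aux (p := p) (α := α) hm u (fun _ => 1) (fun _ => 1) hl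
  simp only [edgeVal_one, mul_one, sum_step hm] at h1
  rw [pexp_pair_aux hm u g g' hl, h1]
  ring

/-- The potential edges from `u` are exchangeable, since the weight depends only on the community of
the source. -/
theorem pexp_pres_mul_inv_swap (u : Vert m n) (l l' : Fin n) :
    pexp (edgeWeight m n p α) (fun ω => pres ω u l * (deg ω u)⁻¹)
      = pexp (edgeWeight m n p α) (fun ω => pres ω u l' * (deg ω u)⁻¹) := by
  let σ : Equiv.Perm (PotEdge m n) := Equiv.prodCongr (Equiv.refl _) (Equiv.swap l l')
  rw [← pexp_comp_perm σ (fun e => rfl) (fun ω => pres ω u l * (deg ω u)⁻¹)]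
  congr 1
  funext ω
  have h1 : pres (fun i => ω (σ i)) u l = pres ω u l' := by
    unfold pres; simp [σ]
  have h2 : deg (fun i => ω (σ i)) u = deg ω u := by
    unfold deg
    rw [← Equiv.sum_comp (Equiv.swap l l') (fun k => pres ω u k)]
    rfl
  rw [h1, h2]

theorem pexp_prod_row (hm : 2 ≤ m) (u : Vert m n) (f : Fin n → EdgeData m → ℝ) :
    pexp (edgeWeight m n p α) (fun ω => ∏ l, f l (ω (u, l)))
      = ∏ l, ∑ d, edgeWeight m n p α (u, l) d * f l d := by
  have := pexp_prod_apply ({u} ×ˢ Finset.univ) (isLaw_edgeWeight (n := n) (p := p) (α := α) hm)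
    (fun e d => f e.2 d)
  simpa only [Finset.prod_product, Finset.prod_singleton] using this

theorem deg_eq_zero_iff (ω : Config m n) (u : Vert m n) :
    deg ω u = 0 ↔ ∀ l, ¬ (ω (u, l)).1 = true := by
  unfold deg
  rw [Finset.sum_eq_zero_iff_of_nonneg fun l _ => pres_nonneg ω u l]
  simp [pres]

open Classical in
/-- The probability that `u` has no out-neighbour. -/
theorem pexp_deg_eq_zero (hm : 2 ≤ m) (u : Vert m n) :
    pexp (edgeWeight m n p α) (fun ω => if deg ω u = 0 then 1 else 0) = (1 - (p : ℝ)) ^ n := by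
  have h : (fun ω : Config m n => if deg ω u = 0 then (1 : ℝ) else 0)
      = fun ω => ∏ l, if (ω (u, l)).1 = true then (0 : ℝ) else 1 := by
    funext ω
    by_cases h : deg ω u = 0
    · rw [if_pos h]
      rw [deg_eq_zero_iff] at h
      exact (Finset.prod_eq_one fun l _ => if_neg (h l)).symm
    · rw [if_neg h]
      rw [deg_eq_zero_iff] at h
      push Not at h
      obtain ⟨l, hl⟩ := h
      rw [Finset.prod_eq_zero (Finset.mem_univ l)]
      exact if_pos hl
  rw [h, pexp_prod_row hm u (fun _ d => if d.1 = true then (0 : ℝ) else 1)]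
  have : ∀ e : PotEdge m n, ∑ d, edgeWeight m n p α e d * (if d.1 = true then (0 : ℝ) else 1)
      = 1 - p := fun e => by
    have := sum_edgeWeight_mul (p := p) (α := α) hm e (fun _ => 0) 1
    simpa using this
  rw [Finset.prod_congr rfl fun l _ => this (u, l)]
  simp

theorem one_sub_pow_le (hn : 1 ≤ n) (hp : Real.log n ≤ n * p) : (1 - (p : ℝ)) ^ n ≤ 1 / n := by
  have hn' : (0 : ℝ) < n := by exact_mod_cast hn
  calc (1 - (p : ℝ)) ^ n ≤ (Real.exp (-p)) ^ n := by
        gcongr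
        · linarith [p.2.2]
        · exact Real.one_sub_le_exp_neg _
    _ = Real.exp (-(n * p)) := by rw [← Real.exp_nat_mul]; ring_nf
    _ ≤ Real.exp (-Real.log n) := by gcongr
    _ = 1 / n := by rw [Real.exp_neg, Real.exp_log hn', one_div]

end DBM

/-! ### One step of the walk -/

namespace DBM

open FinProd DigraphWalk

variable {m n : ℕ} {p α : unitInterval}

-- By exchangeability the left side is the mean of `deg / deg`, which is `1` unless the vertex has
-- no out-edge. No concentration of the degree is needed.
open Classical in
theorem card_mul_pexp_pres (hm : 2 ≤ m) (u : Vert m n) (l : Fin n) :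
    n * pexp (edgeWeight m n p α) (fun ω => pres ω u l * (deg ω u)⁻¹) = 1 - (1 - (p : ℝ)) ^ n := by
  have h1 : ∑ l', pexp (edgeWeight m n p α) (fun ω => pres ω u l' * (deg ω u)⁻¹)
      = n * pexp (edgeWeight m n p α) (fun ω => pres ω u l * (deg ω u)⁻¹) := by
    rw [Finset.sum_congr rfl fun l' _ => pexp_pres_mul_inv_swap u l' l]
    simp
  have h2 : ∀ ω : Config m n, ∑ l', pres ω u l' * (deg ω u)⁻¹
      = 1 - (if deg ω u = 0 then 1 else 0) := by
    intro ω
    rw [← Finset.sum_mul]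
    change deg ω u * (deg ω u)⁻¹ = _
    split_ifs with h
    · simp [h]
    · rw [mul_inv_cancel₀ h]; simp
  rw [← h1, ← pexp_sum, ← pexp_deg_eq_zero (α := α) hm u]
  simp_rw [h2]
  rw [pexp_sub, pexp_const (isLaw_edgeWeight hm)]

theorem pexp_pres_le (hm : 2 ≤ m) (hn : 1 ≤ n) (u : Vert m n) (l : Fin n) :
    pexp (edgeWeight m n p α) (fun ω => pres ω u l * (deg ω u)⁻¹) ≤ 1 / n := by
  have hn' : (0 : ℝ) < n := by exact_mod_cast hn
  have h := card_mul_pexp_pres (p := p) (α := α) hm u l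
  have : 0 ≤ (1 - (p : ℝ)) ^ n := pow_nonneg (by linarith [p.2.2]) n
  rw [le_div_iff₀ hn', mul_comm]
  linarith

/-- A given vertex is reached in one step with annealed probability `O(1 / n)`. -/
theorem pexp_transition_le (hm : 2 ≤ m) (hn : 1 ≤ n) (hp : Real.log n ≤ n * p)
    (u v : Vert m n) :
    pexp (edgeWeight m n p α) (fun ω => transition (graph ω) u v) ≤ 2 / n := by
  classical
  have hw := isLaw_edgeWeight (n := n) (p := p) (α := α) hm
  have h1 : ∀ ω : Config m n, transition (graph ω) u v
      ≤ (if deg ω u = 0 then 1 else 0) + pres ω u v.2 * (deg ω u)⁻¹ := by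
    intro ω
    rw [transition_eq]
    refine add_le_add (by split_ifs <;> norm_num)
      (mul_le_mul_of_nonneg_right ?_ (inv_nonneg.2 (deg_nonneg _ _)))
    rw [← edgeVal_one]
    unfold edgeVal
    by_cases h : (ω (u, v.2)).1 = true
    · rw [if_pos h, if_pos h]; beta_reduce; split_ifs <;> norm_num
    · rw [if_neg h, if_neg h]
  refine (pexp_mono hw h1).trans ?_
  rw [pexp_add, pexp_deg_eq_zero hm]
  have := one_sub_pow_le hn hp
  have := pexp_pres_le (p := p) (α := α) hm hn u v.2
  have e : (2 : ℝ) / n = 1 / n + 1 / n := by ring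
  linarith

theorem edgeVal_nonneg (ω : Config m n) (u : Vert m n) {g : Fin m → ℝ} (hg : ∀ j, 0 ≤ g j)
    (l : Fin n) : 0 ≤ edgeVal ω u g l := by
  unfold edgeVal
  split_ifs
  · exact hg _
  · exact le_rfl

theorem sum_step_mul_nonneg (hm : 2 ≤ m) (i : Fin m) {h : Fin m → ℝ} (h0 : ∀ j, 0 ≤ h j) :
    0 ≤ ∑ j, step (α : ℝ) i j * h j :=
  Finset.sum_nonneg fun j _ => mul_nonneg (step_nonneg hm α.2.1 α.2.2 i j) (h0 j)

theorem sum_step_mul_le_one (hm : 2 ≤ m) (i : Fin m) {h : Fin m → ℝ} (h1 : ∀ j, h j ≤ 1) :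
    ∑ j, step (α : ℝ) i j * h j ≤ 1 := by
  rw [← sum_step hm α i]
  exact Finset.sum_le_sum fun j _ =>
    mul_le_of_le_one_right (step_nonneg hm α.2.1 α.2.2 i j) (h1 j)

/-- After one annealed step the community is nearly distributed according to `step`. -/
theorem sum_pexp_transition_ge (hm : 2 ≤ m) (hn : 1 ≤ n) (hp : Real.log n ≤ n * p)
    (u : Vert m n) {h : Fin m → ℝ} (h0 : ∀ j, 0 ≤ h j) (h1 : ∀ j, h j ≤ 1) :
    ∑ j, step (α : ℝ) (comm u) j * h j - 1 / n
      ≤ ∑ v, pexp (edgeWeight m n p α) (fun ω => transition (graph ω) u v) * h (comm v) := by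
  have hw := isLaw_edgeWeight (n := n) (p := p) (α := α) hm
  have hle := pexp_mono hw fun ω => sum_edgeVal_le ω u (g := fun v => h (comm v)) fun v => h0 _
  rw [pexp_sum, pexp_sum] at hle
  simp only [pexp_mul_const] at hle
  refine le_trans ?_ hle
  change _ ≤ ∑ l, pexp (edgeWeight m n p α) (fun ω => edgeVal ω u h l * (deg ω u)⁻¹)
  set q := ∑ j, step (α : ℝ) (comm u) j * h j
  have hq0 : 0 ≤ q := sum_step_mul_nonneg hm _ h0
  have hq1 : q ≤ 1 := sum_step_mul_le_one hm _ h1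
  have hval : ∑ l, pexp (edgeWeight m n p α) (fun ω => edgeVal ω u h l * (deg ω u)⁻¹)
      = q * (1 - (1 - (p : ℝ)) ^ n) := by
    rw [Finset.sum_congr rfl fun l _ => pexp_edgeVal_mul_inv' (p := p) hm u h l, ← Finset.mul_sum]
    congr 1
    have l0 : Fin n := ⟨0, hn⟩
    rw [Finset.sum_congr rfl fun l' _ => pexp_pres_mul_inv_swap u l' l0, ← card_mul_pexp_pres (α := α) hm u l0]
    simp
  rw [hval]
  have h3 := one_sub_pow_le hn hp
  have h4 : 0 ≤ (1 - (p : ℝ)) ^ n := pow_nonneg (by linarith [p.2.2]) n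
  nlinarith

/-- A nonzero degree is at least half of `1 + degOff`, and the mean of `(1 + degOff)⁻¹` is known:
`p` times it is the mean of `pres * deg⁻¹`, which is at most `1 / n`. -/
theorem pexp_inv_deg_le (hm : 2 ≤ m) (hn : 1 ≤ n) (hp : 0 < (p : ℝ)) (u : Vert m n) :
    pexp (edgeWeight m n p α) (fun ω => (deg ω u)⁻¹) ≤ 2 / (n * p) := by
  have hw := isLaw_edgeWeight (n := n) (p := p) (α := α) hm
  have hn' : (0 : ℝ) < n := by exact_mod_cast hn
  have l : Fin n := ⟨0, hn⟩
  have h1 : ∀ ω : Config m n, (deg ω u)⁻¹ ≤ 2 * (1 + degOff ω u {l})⁻¹ := by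
    intro ω
    have h0 := degOff_nonneg ω u {l}
    rcases eq_or_ne (deg ω u) 0 with h | h
    · rw [h, inv_zero]; positivity
    · have hd : 1 ≤ deg ω u := by
        rw [← outDeg_eq] at h ⊢
        exact_mod_cast Nat.one_le_iff_ne_zero.2 (by exact_mod_cast h)
      have hle : degOff ω u {l} ≤ deg ω u := by
        rw [deg_eq_sum_add ω u {l}, Finset.sum_singleton]
        linarith [pres_nonneg ω u l]
      rw [inv_eq_one_div, ← div_eq_mul_inv, div_le_div_iff₀ (by linarith) (by linarith)]
      linarith
  refine (pexp_mono hw h1).trans ?_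
  rw [pexp_const_mul]
  have h2 := pexp_pres_le (p := p) (α := α) hm hn u l
  rw [pexp_pres_mul_inv hm] at h2
  have h3 : pexp (edgeWeight m n p α) (fun ω => (1 + degOff ω u {l})⁻¹) ≤ 1 / (n * p) := by
    rw [le_div_iff₀ (by positivity)]
    rw [le_div_iff₀ hn'] at h2
    linarith
  have e : (2 : ℝ) / (n * p) = 2 * (1 / (n * p)) := by ring
  rw [e]
  linarith

/-- Two independent quenched steps from the same vertex are nearly independent under the annealed
law, and reach distinct vertices with high probability. -/
theorem sum_pexp_transition_pair_ge (hm : 2 ≤ m) (hn : 1 ≤ n) (hp : Real.log n ≤ n * p)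
    (hp0 : 0 < (p : ℝ)) (u : Vert m n) {h h' : Fin m → ℝ} (h0 : ∀ j, 0 ≤ h j) (h1 : ∀ j, h j ≤ 1)
    (h0' : ∀ j, 0 ≤ h' j) (h1' : ∀ j, h' j ≤ 1) :
    (∑ j, step (α : ℝ) (comm u) j * h j) * (∑ j, step (α : ℝ) (comm u) j * h' j)
        - (1 / n + 2 / (n * p))
      ≤ ∑ v, ∑ v', if v = v' then 0 else
        pexp (edgeWeight m n p α) (fun ω => transition (graph ω) u v * transition (graph ω) u v')
          * (h (comm v) * h' (comm v')) := by
  classical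
  have hw := isLaw_edgeWeight (n := n) (p := p) (α := α) hm
  -- Keep only pairs of edges with distinct labels: they are distinct coordinates of `ω`, and they
  -- lead to distinct vertices.
  have hpt : ∀ ω : Config m n, ∑ l, ∑ l', (if l = l' then 0 else
        edgeVal ω u h l * edgeVal ω u h' l' * ((deg ω u)⁻¹ * (deg ω u)⁻¹))
      ≤ ∑ v, ∑ v', if v = v' then 0 else
        transition (graph ω) u v * transition (graph ω) u v' * (h (comm v) * h' (comm v')) := by
    intro ω
    calc ∑ l, ∑ l', (if l = l' then 0 else
          edgeVal ω u h l * edgeVal ω u h' l' * ((deg ω u)⁻¹ * (deg ω u)⁻¹))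
        = ∑ l, edgeVal ω u h l * (deg ω u)⁻¹ * ∑ l', edgeVal ω u
            (fun j' => if l = l' then 0 else h' j') l' * (deg ω u)⁻¹ := by
          refine Finset.sum_congr rfl fun l _ => ?_
          rw [Finset.mul_sum]
          refine Finset.sum_congr rfl fun l' _ => ?_
          by_cases hl : l = l'
          · simp [edgeVal, hl]
          · simp only [if_neg hl]; ring
      _ ≤ ∑ l, edgeVal ω u h l * (deg ω u)⁻¹ *
            ∑ v', transition (graph ω) u v' * (if l = v'.2 then 0 else h' v'.1) := by
          refine Finset.sum_le_sum fun l _ => mul_le_mul_of_nonneg_left ?_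
            (mul_nonneg (edgeVal_nonneg ω u h0 l) (inv_nonneg.2 (deg_nonneg ω u)))
          exact sum_edgeVal_le ω u (g := fun v' => if l = v'.2 then 0 else h' v'.1) fun v' => by
            split_ifs
            · exact le_rfl
            · exact h0' _
      _ = ∑ l, edgeVal ω u (fun j => h j *
            ∑ v', transition (graph ω) u v' * (if l = v'.2 then 0 else h' v'.1)) l
            * (deg ω u)⁻¹ := by
          refine Finset.sum_congr rfl fun l _ => ?_
          unfold edgeVal
          split_ifs
          · ring
          · ring
      _ ≤ ∑ v, transition (graph ω) u v * (h v.1 *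
            ∑ v', transition (graph ω) u v' * (if v.2 = v'.2 then 0 else h' v'.1)) := by
          refine sum_edgeVal_le ω u (g := fun v => h v.1 *
            ∑ v', transition (graph ω) u v' * (if v.2 = v'.2 then 0 else h' v'.1)) fun v => ?_
          refine mul_nonneg (h0 _) (Finset.sum_nonneg fun v' _ =>
            mul_nonneg (transition_nonneg _ _ _) ?_)
          split_ifs
          · exact le_rfl
          · exact h0' _
      _ ≤ _ := by
          refine Finset.sum_le_sum fun v _ => ?_
          rw [Finset.mul_sum, Finset.mul_sum]
          refine Finset.sum_le_sum fun v' _ => ?_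
          have hnn : 0 ≤ transition (graph ω) u v * transition (graph ω) u v' *
              (h (comm v) * h' (comm v')) :=
            mul_nonneg (mul_nonneg (transition_nonneg _ _ _) (transition_nonneg _ _ _))
              (mul_nonneg (h0 _) (h0' _))
          by_cases hv : v = v'
          · simp [hv]
          · rw [if_neg hv]
            split_ifs
            · simpa using hnn
            · refine le_of_eq ?_
              simp only [comm]
              ring
  have hle := pexp_mono hw hpt
  have e2 : pexp (edgeWeight m n p α) (fun ω => ∑ v, ∑ v', if v = v' then 0 else
        transition (graph ω) u v * transition (graph ω) u v' * (h (comm v) * h' (comm v')))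
      = ∑ v, ∑ v', if v = v' then 0 else
        pexp (edgeWeight m n p α) (fun ω => transition (graph ω) u v * transition (graph ω) u v')
          * (h (comm v) * h' (comm v')) := by
    rw [pexp_sum]
    refine Finset.sum_congr rfl fun v _ => ?_
    rw [pexp_sum]
    refine Finset.sum_congr rfl fun v' _ => ?_
    split_ifs
    · exact pexp_const hw 0
    · exact pexp_mul_const _ _
  rw [e2] at hle
  refine le_trans ?_ hle
  set q := ∑ j, step (α : ℝ) (comm u) j * h j
  set q' := ∑ j, step (α : ℝ) (comm u) j * h' j
  have hq0 : 0 ≤ q := sum_step_mul_nonneg hm _ h0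
  have hq1 : q ≤ 1 := sum_step_mul_le_one hm _ h1
  have hq0' : 0 ≤ q' := sum_step_mul_nonneg hm _ h0'
  have hq1' : q' ≤ 1 := sum_step_mul_le_one hm _ h1'
  have e1 : pexp (edgeWeight m n p α) (fun ω => ∑ l, ∑ l', (if l = l' then 0 else
        edgeVal ω u h l * edgeVal ω u h' l' * ((deg ω u)⁻¹ * (deg ω u)⁻¹)))
      = q * q' * pexp (edgeWeight m n p α) (fun ω => ∑ l, ∑ l', (if l = l' then 0 else
        pres ω u l * pres ω u l' * ((deg ω u)⁻¹ * (deg ω u)⁻¹))) := by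
    rw [pexp_sum, pexp_sum, Finset.mul_sum]
    refine Finset.sum_congr rfl fun l _ => ?_
    rw [pexp_sum, pexp_sum, Finset.mul_sum]
    refine Finset.sum_congr rfl fun l' _ => ?_
    split_ifs with hl
    · simp [pexp_const hw]
    · exact pexp_pair hm u h h' hl
  -- The sum off the diagonal is `(deg ^ 2 - deg) / deg ^ 2`; the loss `deg⁻¹` is the chance that
  -- both walkers take the same edge.
  have e3 : ∀ ω : Config m n, ∑ l, ∑ l', (if l = l' then 0 else
        pres ω u l * pres ω u l' * ((deg ω u)⁻¹ * (deg ω u)⁻¹))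
      = 1 - (if deg ω u = 0 then 1 else 0) - (deg ω u)⁻¹ := by
    intro ω
    have : ∀ l l', (if l = l' then 0 else
        pres ω u l * pres ω u l' * ((deg ω u)⁻¹ * (deg ω u)⁻¹))
        = pres ω u l * pres ω u l' * ((deg ω u)⁻¹ * (deg ω u)⁻¹)
          - if l = l' then pres ω u l * ((deg ω u)⁻¹ * (deg ω u)⁻¹) else 0 := by
      intro l l'
      split_ifs with hl
      · subst hl
        rw [pres_mul_self]; ring
      · ring
    simp only [this, Finset.sum_sub_distrib, Finset.sum_ite_eq, Finset.mem_univ, if_true,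
      ← Finset.sum_mul, ← Finset.mul_sum]
    change deg ω u * deg ω u * _ - deg ω u * _ = _
    split_ifs with hd
    · simp [hd]
    · field_simp
      simp
  rw [e1]
  simp_rw [e3]
  rw [pexp_sub, pexp_sub, pexp_const hw, pexp_deg_eq_zero hm]
  have h3 := one_sub_pow_le hn hp
  have h4 : 0 ≤ (1 - (p : ℝ)) ^ n := pow_nonneg (by linarith [p.2.2]) n
  have h5 := pexp_inv_deg_le (α := α) hm hn hp0 u
  have h6 : 0 ≤ pexp (edgeWeight m n p α) (fun ω => (deg ω u)⁻¹) :=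
    pexp_nonneg hw fun ω => inv_nonneg.2 (deg_nonneg ω u)
  have h7 : 0 ≤ q * q' := mul_nonneg hq0 hq0'
  have h8 : q * q' ≤ 1 := mul_le_one₀ hq1 hq0' hq1'
  nlinarith

/-! ### Exponential bound for the out-edges of one vertex. -/

/-- Number of edges from `u` that lead to `B`. -/
def edgesTo (ω : Config m n) (u : Vert m n) (B : Fin m → Fin n → Prop)
    [∀ j l, Decidable (B j l)] : ℝ :=
  ∑ l, edgeVal ω u (fun j => if B j l then 1 else 0) l

/-- Large deviations for the number of edges from `u` to a set `B` of low density. -/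
theorem prob_edgesTo_le (hm : 2 ≤ m) (u : Vert m n) (B : Fin m → Fin n → Prop)
    [∀ j l, Decidable (B j l)] {θ η : ℝ} (hθ : 0 ≤ θ) (hη : 0 < η) :
    prob (edgeWeight m n p α) {ω | η * deg ω u ≤ edgesTo ω u B}
      ≤ Real.exp (-(n * p * (1 - Real.exp (-θ))) + p * (Real.exp (θ / η) *
        ∑ l, ∑ j, step (α : ℝ) (comm u) j * (if B j l then 1 else 0))) := by
  have hw := isLaw_edgeWeight (n := n) (p := p) (α := α) hm
  -- Exponential Markov inequality with tilt `θ / η` on the edges into `B`, matched by `-θ` on every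
  -- edge; the expression then splits over the labels.
  have h1 : prob (edgeWeight m n p α) {ω | η * deg ω u ≤ edgesTo ω u B}
      ≤ pexp (edgeWeight m n p α) (fun ω => Real.exp (θ / η * edgesTo ω u B - θ * deg ω u)) := by
    refine prob_le_pexp hw (fun ω => (Real.exp_pos _).le) fun ω hω => ?_
    rw [Real.one_le_exp_iff]
    have : θ / η * (η * deg ω u) ≤ θ / η * edgesTo ω u B :=
      mul_le_mul_of_nonneg_left hω (by positivity)
    have e : θ / η * (η * deg ω u) = θ * deg ω u := by field_simp
    linarith
  refine h1.trans ?_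
  have h2 : ∀ ω : Config m n, Real.exp (θ / η * edgesTo ω u B - θ * deg ω u)
      = ∏ l, if (ω (u, l)).1 = true then
        Real.exp (θ / η * (if B (target (comm u) (ω (u, l))) l then 1 else 0) - θ) else 1 := by
    intro ω
    unfold edgesTo deg
    rw [Finset.mul_sum, Finset.mul_sum, ← Finset.sum_sub_distrib, Real.exp_sum]
    refine Finset.prod_congr rfl fun l _ => ?_
    unfold edgeVal pres
    by_cases h : (ω (u, l)).1 = true
    · simp only [if_pos h, mul_one]
    · simp only [if_neg h, mul_zero, sub_zero, Real.exp_zero]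
  simp_rw [h2]
  rw [pexp_prod_row hm u (fun l d => if d.1 = true then
        Real.exp (θ / η * (if B (target (comm u) d) l then 1 else 0) - θ) else 1)]
  have h3 : ∀ l : Fin n, ∑ d, edgeWeight m n p α (u, l) d * (if d.1 = true then
        Real.exp (θ / η * (if B (target (comm u) d) l then 1 else 0) - θ) else 1)
      ≤ Real.exp (-(p * (1 - Real.exp (-θ))) + p * (Real.exp (θ / η) *
        ∑ j, step (α : ℝ) (comm u) j * (if B j l then 1 else 0))) := by
    intro l
    rw [sum_edgeWeight_mul hm (u, l)
      (fun j => Real.exp (θ / η * (if B j l then 1 else 0) - θ)) 1]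
    have h4 : ∑ j, step (α : ℝ) (comm u) j * Real.exp (θ / η * (if B j l then 1 else 0) - θ)
        ≤ Real.exp (-θ) + Real.exp (θ / η) *
          ∑ j, step (α : ℝ) (comm u) j * (if B j l then 1 else 0) := by
      have : Real.exp (-θ) = ∑ j, step (α : ℝ) (comm u) j * Real.exp (-θ) := by
        rw [← Finset.sum_mul, sum_step hm, one_mul]
      rw [this, Finset.mul_sum, ← Finset.sum_add_distrib]
      refine Finset.sum_le_sum fun j _ => ?_
      have hs := step_nonneg hm α.2.1 α.2.2 (comm u) j
      split_ifs
      · have : Real.exp (θ / η * 1 - θ) ≤ Real.exp (θ / η) := by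
          gcongr; linarith
        have := Real.exp_pos (-θ)
        nlinarith
      · simp
    have hp0 := p.2.1
    have h5 := Real.add_one_le_exp (-(p * (1 - Real.exp (-θ))) + p * (Real.exp (θ / η) *
        ∑ j, step (α : ℝ) (comm u) j * (if B j l then 1 else 0)))
    have h6 := mul_le_mul_of_nonneg_left h4 hp0
    change (1 - (p : ℝ)) * 1 + p * ∑ j, step (α : ℝ) (comm u) j *
      Real.exp (θ / η * (if B j l then 1 else 0) - θ) ≤ _
    linarith
  refine (Finset.prod_le_prod (fun l _ => Finset.sum_nonneg fun d _ =>
    mul_nonneg (hw.nonneg _ _) (by split_ifs <;> positivity)) fun l _ => h3 l).trans ?_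
  rw [← Real.exp_sum, Finset.sum_add_distrib, ← Finset.mul_sum, ← Finset.mul_sum]
  simp [mul_assoc]

end DBM

/-! ### Self-avoiding trajectories -/

namespace DBM

open FinProd DigraphWalk

variable {m n : ℕ} {p α : unitInterval}

/-- Quenched mass of the self-avoiding trajectories of `s` steps from `u` that avoid `S`, with a
terminal weight `F` that may depend on the set of vertices visited before. -/
noncomputable def avoidWalk (F : Config m n → Finset (Vert m n) → Vert m n → ℝ) :
    ℕ → Config m n → Finset (Vert m n) → Vert m n → ℝ
  | 0, ω, S, u => if u ∈ S then 0 else F ω S u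
  | s + 1, ω, S, u => if u ∈ S then 0 else
      ∑ v, transition (graph ω) u v * avoidWalk F s ω (insert u S) v

variable {F : Config m n → Finset (Vert m n) → Vert m n → ℝ}

theorem avoidWalk_of_mem (s : ℕ) (ω : Config m n) {S : Finset (Vert m n)} {u : Vert m n}
    (h : u ∈ S) : avoidWalk F s ω S u = 0 := by
  cases s <;> simp [avoidWalk, h]

theorem avoidWalk_nonneg (hF : ∀ ω S u, 0 ≤ F ω S u) (s : ℕ) (ω : Config m n)
    (S : Finset (Vert m n)) (u : Vert m n) : 0 ≤ avoidWalk F s ω S u := by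
  induction s generalizing S u with
  | zero =>
    simp only [avoidWalk]
    split_ifs
    · exact le_rfl
    · exact hF _ _ _
  | succ s ih =>
    simp only [avoidWalk]
    split_ifs
    · exact le_rfl
    · exact Finset.sum_nonneg fun v _ => mul_nonneg (transition_nonneg _ _ _) (ih _ _)

/-- The walk only leaves from vertices outside `S`, so the rows of `S` are never consulted. -/
theorem dependsOn_avoidWalk
    (hF : ∀ S u, u ∉ S → DependsOn (fun ω => F ω S u) (rows (S : Set (Vert m n))ᶜ)) (s : ℕ)
    (S : Finset (Vert m n)) (u : Vert m n) :
    DependsOn (fun ω => avoidWalk F s ω S u) (rows (S : Set (Vert m n))ᶜ) := by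
  induction s generalizing S u with
  | zero =>
    intro x y h
    simp only [avoidWalk]
    split_ifs with hu
    · rfl
    · exact hF S u hu h
  | succ s ih =>
    intro x y h
    simp only [avoidWalk]
    split_ifs with hu
    · rfl
    · refine Finset.sum_congr rfl fun v _ => ?_
      have h1 := transition_congr (ω := x) (ω' := y) (u := u)
        (fun l => h (u, l) (by simpa [rows] using hu)) v
      have h2 := ih (insert u S) v (x := x) (y := y) fun e he => h e (by
        simp only [rows, Set.mem_ofPred_eq, Set.mem_compl_iff, Finset.coe_insert] at he ⊢
        exact fun h' => he (Set.mem_insert_of_mem _ h'))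
      simp only at h2
      rw [h1, h2]

/-- The row of `u` serves for the first step and is never read again, because `u` joins the
forbidden set. This independence is the annealed Markov property. -/
theorem pexp_avoidWalk_succ (hm : 2 ≤ m)
    (hF : ∀ S u, u ∉ S → DependsOn (fun ω => F ω S u) (rows (S : Set (Vert m n))ᶜ)) (s : ℕ)
    {S : Finset (Vert m n)} {u : Vert m n} (hu : u ∉ S) :
    pexp (edgeWeight m n p α) (fun ω => avoidWalk F (s + 1) ω S u)
      = ∑ v, pexp (edgeWeight m n p α) (fun ω => transition (graph ω) u v)
        * pexp (edgeWeight m n p α) (fun ω => avoidWalk F s ω (insert u S) v) := by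
  simp only [avoidWalk, if_neg hu]
  rw [pexp_sum]
  refine Finset.sum_congr rfl fun v _ => ?_
  refine pexp_mul_of_dependsOn_of_disjoint (isLaw_edgeWeight hm) (dependsOn_transition u v)
    (dependsOn_avoidWalk hF s (insert u S) v) ?_
  rw [Set.disjoint_left]
  intro e he he'
  simp only [rows, Set.mem_ofPred_eq, Set.mem_singleton_iff] at he he'
  subst he
  simp at he'

theorem sum_pexp_transition (hm : 2 ≤ m) (u : Vert m n) :
    ∑ v, pexp (edgeWeight m n p α) (fun ω => transition (graph ω) u v) = 1 := by
  rw [← pexp_sum]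
  simp_rw [transition_row_sum]
  exact pexp_const (isLaw_edgeWeight hm) 1

/-- Under the annealed law the trajectories that are self-avoiding carry nearly all the mass, and
the community along them is nearly a Markov chain with transition matrix `step`. -/
theorem pexp_avoidWalk_ge (hm : 2 ≤ m) (hn : 1 ≤ n) (hp : Real.log n ≤ n * p)
    (hF0 : ∀ ω S u, 0 ≤ F ω S u)
    (hF : ∀ S u, u ∉ S → DependsOn (fun ω => F ω S u) (rows (S : Set (Vert m n))ᶜ))
    {h : ℕ → Fin m → ℝ} (h0 : ∀ s j, 0 ≤ h s j) (h1 : ∀ s j, h s j ≤ 1)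
    (hs : ∀ s i, h (s + 1) i = ∑ j, step (α : ℝ) i j * h s j)
    (X : Finset (Vert m n)) (N : ℕ) {e : ℝ} (he : 0 ≤ e)
    (hFe : ∀ S u, S.card ≤ N → Disjoint S X → u ∉ S → u ∉ X →
      h 0 (comm u) - e ≤ pexp (edgeWeight m n p α) (fun ω => F ω S u)) :
    ∀ (s : ℕ) (S : Finset (Vert m n)) (u : Vert m n), S.card + s ≤ N → Disjoint S X → u ∉ S →
      u ∉ X → h s (comm u) - (e + s * ((2 * (N + X.card) + 1) / n))
        ≤ pexp (edgeWeight m n p α) (fun ω => avoidWalk F s ω S u) := by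
  have hw := isLaw_edgeWeight (n := n) (p := p) (α := α) hm
  have hn' : (0 : ℝ) < n := by exact_mod_cast hn
  intro s
  induction s with
  | zero =>
    intro S u hS hSX hu huX
    have := hFe S u (by omega) hSX hu huX
    simpa [avoidWalk, hu] using this
  | succ s ih =>
    intro S u hS hSX hu huX
    rw [pexp_avoidWalk_succ hm hF s hu]
    -- Cost of one step: `1 / n` for having no out-neighbour, and `2 / n` for each of the at most `N
    -- + X.card` forbidden vertices.
    set c : ℝ := (2 * (N + X.card) + 1) / n with hc
    have hc0 : 0 ≤ c := by positivity
    set τ : Vert m n → ℝ := fun v =>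
      pexp (edgeWeight m n p α) (fun ω => transition (graph ω) u v) with hτ
    have hτ0 : ∀ v, 0 ≤ τ v := fun v => pexp_nonneg hw fun ω => transition_nonneg _ _ _
    have hcard : (insert u S).card ≤ s.succ + S.card := by
      have := Finset.card_insert_le u S
      omega
    have hterm : ∀ v, τ v * h s (comm v) - τ v * (e + s * c)
        - (if v ∈ insert u S ∪ X then τ v else 0)
        ≤ τ v * pexp (edgeWeight m n p α) (fun ω => avoidWalk F s ω (insert u S) v) := by
      intro v
      have hnn : 0 ≤ pexp (edgeWeight m n p α) (fun ω => avoidWalk F s ω (insert u S) v) :=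
        pexp_nonneg hw fun ω => avoidWalk_nonneg hF0 s ω _ v
      split_ifs with hv
      · have a1 := mul_nonneg (hτ0 v) hnn
        have a2 := mul_le_mul_of_nonneg_left (h1 s (comm v)) (hτ0 v)
        have a3 : 0 ≤ τ v * (e + s * c) := mul_nonneg (hτ0 v) (by positivity)
        linarith
      · rw [Finset.mem_union, not_or] at hv
        have := ih (insert u S) v (by have := Finset.card_insert_of_notMem hu; omega)
          (Finset.disjoint_insert_left.2 ⟨huX, hSX⟩) hv.1 hv.2
        have := mul_le_mul_of_nonneg_left this (hτ0 v)
        linarith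
    refine le_trans ?_ (Finset.sum_le_sum fun v _ => hterm v)
    rw [Finset.sum_sub_distrib, Finset.sum_sub_distrib, ← Finset.sum_mul,
      sum_pexp_transition hm u, Finset.sum_ite_mem, Finset.univ_inter]
    have b1 := sum_pexp_transition_ge (α := α) hm hn hp u (h0 s) (h1 s)
    rw [← hs] at b1
    have b2 : ∑ v ∈ insert u S ∪ X, τ v ≤ (N + X.card) * (2 / n) := by
      calc ∑ v ∈ insert u S ∪ X, τ v ≤ ∑ v ∈ insert u S ∪ X, (2 / n : ℝ) :=
            Finset.sum_le_sum fun v _ => pexp_transition_le hm hn hp u v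
        _ = ((insert u S ∪ X).card : ℝ) * (2 / n) := by rw [Finset.sum_const, nsmul_eq_mul]
        _ ≤ _ := by
            gcongr
            have a1 := Finset.card_union_le (insert u S) X
            have a2 : (insert u S).card ≤ N := by
              have := Finset.card_insert_le u S
              omega
            exact_mod_cast a1.trans (by omega)
    have b3 : c = 1 / n + (N + X.card) * (2 / n) := by rw [hc]; ring
    push_cast
    linarith

/-! ### The community chain and the unrestricted walk. -/

/-- Transition probabilities of the community process. -/
theorem Q_zero (hm : 2 ≤ m) (α : ℝ) (i j : Fin m) : Q α 0 i j = if i = j then 1 else 0 := by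
  have h : (2 : ℝ) ≤ m := by exact_mod_cast hm
  unfold Q
  split_ifs
  · field_simp; ring
  · simp

/-- As a function of its first argument, `Q` is a constant plus the `s`-th power of the eigenvalue
times an indicator, so the kernel need only be applied to the indicator. -/
theorem Q_succ (hm : 2 ≤ m) (α : ℝ) (s : ℕ) (i j : Fin m) :
    Q α (s + 1) i j = ∑ k, step α i k * Q α s k j := by
  have h : (2 : ℝ) ≤ m := by exact_mod_cast hm
  have h2 : (m : ℝ) - 1 ≠ 0 := by linarith
  have h3 : (m : ℝ) ≠ 0 := by linarith
  have e1 : ∑ k, step α i k * (if k = j then (1 : ℝ) else 0) = step α i j := by simp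
  have e2 : ∑ k, step α i k * Q α s k j = (1 + ((m : ℝ) * step α i j - 1) *
      (1 - (m : ℝ) / ((m : ℝ) - 1) * α) ^ s) / m := by
    have : ∀ k, step α i k * Q α s k j = step α i k * ((1 - (1 - (m : ℝ) / ((m : ℝ) - 1) * α) ^ s) / m)
        + step α i k * (if k = j then (1 : ℝ) else 0) * (1 - (m : ℝ) / ((m : ℝ) - 1) * α) ^ s := by
      intro k
      unfold Q
      field_simp
      ring
    simp only [this, Finset.sum_add_distrib, ← Finset.sum_mul, sum_step hm, e1]
    field_simp
    ring
  rw [e2]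
  unfold Q step
  congr 2
  rw [pow_succ']
  by_cases hij : i = j
  · subst hij
    simp only [if_true]
    field_simp
    ring
  · rw [if_neg hij, if_neg (Ne.symm hij)]
    field_simp
    ring

theorem Q_nonneg (hm : 2 ≤ m) (s : ℕ) (i j : Fin m) : 0 ≤ Q (α : ℝ) s i j := by
  induction s generalizing i with
  | zero => rw [Q_zero hm]; split_ifs <;> norm_num
  | succ s ih =>
    rw [Q_succ hm]
    exact sum_step_mul_nonneg hm i ih

theorem sum_Q (hm : 2 ≤ m) (α : ℝ) (s : ℕ) (i : Fin m) : ∑ j, Q α s i j = 1 := by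
  induction s generalizing i with
  | zero => simp [Q_zero hm]
  | succ s ih =>
    simp only [Q_succ hm]
    rw [Finset.sum_comm]
    simp only [← Finset.mul_sum, ih, mul_one, sum_step hm]

theorem Q_le_one (hm : 2 ≤ m) (s : ℕ) (i j : Fin m) : Q (α : ℝ) s i j ≤ 1 := by
  rw [← sum_Q hm (α : ℝ) s i]
  exact Finset.single_le_sum (fun j _ => Q_nonneg hm s i j) (Finset.mem_univ j)

/-- The law at time `s` of the walk, tested against `g`. -/
noncomputable def walk (ω : Config m n) (g : Vert m n → ℝ) : ℕ → Vert m n → ℝ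
  | 0, u => g u
  | s + 1, u => ∑ v, transition (graph ω) u v * walk ω g s v

theorem walk_eq_sum_pow [DecidableEq (Vert m n)] (ω : Config m n) (g : Vert m n → ℝ) (s : ℕ) (u : Vert m n) :
    walk ω g s u = ∑ v, (transition (graph ω) ^ s) u v * g v := by
  induction s generalizing u with
  | zero => simp [walk, Matrix.one_apply]
  | succ s ih =>
    simp only [walk, ih, pow_succ', Matrix.mul_apply, Finset.sum_mul, Finset.mul_sum]
    rw [Finset.sum_comm]
    simp only [mul_assoc]

/-- Indicator of the community `i`. -/
def ind (i : Fin m) (v : Vert m n) : ℝ := if comm v = i then 1 else 0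

theorem ind_nonneg (i : Fin m) (v : Vert m n) : 0 ≤ ind i v := by
  unfold ind; split_ifs <;> norm_num

theorem quenchedProb_eq_walk (ω : Config m n) (u : Vert m n) (t : ℕ) (i : Fin m) :
    quenchedProb (graph ω) u t (community n i) = walk ω (ind i) t u := by
  classical
  rw [@walk_eq_sum_pow _ _ (Classical.decEq _)]
  unfold quenchedProb
  refine Finset.sum_congr rfl fun v _ => ?_
  unfold ind community
  by_cases h : comm v = i <;> simp [h]

theorem walk_nonneg (ω : Config m n) {g : Vert m n → ℝ} (hg : ∀ v, 0 ≤ g v) (s : ℕ)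
    (u : Vert m n) : 0 ≤ walk ω g s u := by
  induction s generalizing u with
  | zero => exact hg u
  | succ s ih => exact Finset.sum_nonneg fun v _ => mul_nonneg (transition_nonneg _ _ _) (ih v)

theorem sum_walk_ind (ω : Config m n) (s : ℕ) (u : Vert m n) :
    ∑ i, walk ω (ind i) s u = 1 := by
  induction s generalizing u with
  | zero => simp [walk, ind]
  | succ s ih =>
    simp only [walk]
    rw [Finset.sum_comm]
    simp only [← Finset.mul_sum, ih, mul_one, transition_row_sum]

/-- Dropping the avoidance constraint only adds mass. The factor `c` carries the contribution of a
second walk, which bounds the terminal weight of `avoidPair`. -/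
theorem avoidWalk_le_mul {F : Config m n → Finset (Vert m n) → Vert m n → ℝ} {ω : Config m n}
    {g : Vert m n → ℝ} (hg : ∀ v, 0 ≤ g v) {c : ℝ} (hc : 0 ≤ c) (hF : ∀ S u, F ω S u ≤ g u * c)
    (s : ℕ) (S : Finset (Vert m n)) (u : Vert m n) :
    avoidWalk F s ω S u ≤ walk ω g s u * c := by
  induction s generalizing S u with
  | zero =>
    simp only [avoidWalk, walk]
    split_ifs
    · exact mul_nonneg (hg u) hc
    · exact hF S u
  | succ s ih =>
    simp only [avoidWalk, walk]
    split_ifs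
    · exact mul_nonneg (Finset.sum_nonneg fun v _ =>
        mul_nonneg (transition_nonneg _ _ _) (walk_nonneg ω hg s v)) hc
    · rw [Finset.sum_mul]
      refine Finset.sum_le_sum fun v _ => ?_
      rw [mul_assoc]
      exact mul_le_mul_of_nonneg_left (ih _ _) (transition_nonneg _ _ _)

end DBM

/-! ### The second moment -/

namespace DBM

open FinProd DigraphWalk

variable {m n : ℕ} {p α : unitInterval}

/-- Self-avoiding trajectories that avoid `S` and end in the community `b`. -/
noncomputable abbrev avoidTo (b : Fin m) : ℕ → Config m n → Finset (Vert m n) → Vert m n → ℝ :=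
  avoidWalk (fun _ _ v => ind b v)

/-- Pairs of self-avoiding trajectories that avoid `S` and each other, the first of which ends in
the community `a`, the second of which starts at `v'` and ends in the community `b`. -/
noncomputable abbrev avoidPair (a b : Fin m) (s : ℕ) (v' : Vert m n) :
    ℕ → Config m n → Finset (Vert m n) → Vert m n → ℝ :=
  avoidWalk (fun ω S u => ind a u * avoidTo b s ω (insert u S) v')

theorem dependsOn_ind (b : Fin m) (S : Finset (Vert m n)) (u : Vert m n) :
    DependsOn (fun _ : Config m n => ind b u) (rows (S : Set (Vert m n))ᶜ) := fun _ _ _ => rfl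

theorem pexp_avoidTo_ge (hm : 2 ≤ m) (hn : 1 ≤ n) (hp : Real.log n ≤ n * p) (b : Fin m)
    (N s : ℕ) (S : Finset (Vert m n)) (u : Vert m n) (hS : S.card + s ≤ N) (hu : u ∉ S) :
    Q (α : ℝ) s (comm u) b - s * ((2 * N + 1) / n)
      ≤ pexp (edgeWeight m n p α) (fun ω => avoidTo b s ω S u) := by
  have := pexp_avoidWalk_ge (α := α) hm hn hp (F := fun _ _ v => ind b v)
    (fun _ _ u => ind_nonneg b u) (fun S u _ => dependsOn_ind b S u)
    (h := fun s j => Q (α : ℝ) s j b) (fun s j => Q_nonneg hm s j b) (fun s j => Q_le_one hm s j b)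
    (fun s j => Q_succ hm _ s j b) ∅ N (e := 0) le_rfl (fun S u _ _ _ _ => by
      rw [pexp_const (isLaw_edgeWeight hm)]
      simp [Q_zero hm, ind]) s S u hS (Finset.disjoint_empty_right S) hu (Finset.notMem_empty u)
  simpa using this

theorem dependsOn_avoidPair_terminal (a b : Fin m) (s : ℕ) (v' : Vert m n)
    (S : Finset (Vert m n)) (u : Vert m n) :
    DependsOn (fun ω : Config m n => ind a u * avoidTo b s ω (insert u S) v')
      (rows (S : Set (Vert m n))ᶜ) := by
  intro x y h
  have := dependsOn_avoidWalk (F := fun _ _ v => ind b v) (fun S u _ => dependsOn_ind b S u) s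
    (insert u S) v' (x := x) (y := y) fun e he => h e (by
      simp only [rows, Set.mem_ofPred_eq, Set.mem_compl_iff, Finset.coe_insert] at he ⊢
      exact fun h' => he (Set.mem_insert_of_mem _ h'))
  exact congrArg (ind a u * ·) this

theorem avoidPair_terminal_nonneg (a b : Fin m) (s : ℕ) (v' : Vert m n) (ω : Config m n)
    (S : Finset (Vert m n)) (u : Vert m n) :
    0 ≤ ind a u * avoidTo b s ω (insert u S) v' :=
  mul_nonneg (ind_nonneg a u) (avoidWalk_nonneg (fun _ _ v => ind_nonneg b v) _ _ _ _)

theorem pexp_avoidPair_ge (hm : 2 ≤ m) (hn : 1 ≤ n) (hp : Real.log n ≤ n * p) (a b : Fin m)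
    (s : ℕ) {u v v' : Vert m n} (hv : v ≠ u) (hv' : v' ≠ u) (hvv : v ≠ v') :
    Q (α : ℝ) s (comm v) a * Q (α : ℝ) s (comm v') b - 2 * s * ((4 * s + 5) / n)
      ≤ pexp (edgeWeight m n p α) (fun ω => avoidPair a b s v' s ω {u} v) := by
  have hw := isLaw_edgeWeight (n := n) (p := p) (α := α) hm
  have hn' : (0 : ℝ) < n := by exact_mod_cast hn
  have hq0 := Q_nonneg (α := α) hm s (comm v') b
  have hq1 := Q_le_one (α := α) hm s (comm v') b
  have he : (0 : ℝ) ≤ s * ((4 * s + 5) / n) := by positivity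
  -- The estimate is used twice. The second walk avoids at most `s + 2` vertices, so its budget is
  -- `2 * s + 2`, whence `4 * s + 5`; its probability is then the terminal weight of the first walk,
  -- which avoids `v'` through `X = {v'}`.
  have := pexp_avoidWalk_ge (α := α) hm hn hp
    (F := fun ω S u => ind a u * avoidTo b s ω (insert u S) v')
    (avoidPair_terminal_nonneg a b s v')
    (fun S u _ => dependsOn_avoidPair_terminal a b s v' S u)
    (h := fun s' j => Q (α : ℝ) s' j a * Q (α : ℝ) s (comm v') b)
    (fun s' j => mul_nonneg (Q_nonneg hm s' j a) hq0)
    (fun s' j => mul_le_one₀ (Q_le_one hm s' j a) hq0 hq1)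
    (fun s' j => by
      rw [Q_succ hm, Finset.sum_mul]
      simp only [mul_assoc]) {v'} (s + 1) he
    (fun S w hS hSX hw1 hw2 => by
      rw [pexp_const_mul]
      have h1 := pexp_avoidTo_ge (α := α) hm hn hp b (2 * s + 2) s (insert w S) v'
        (by have := Finset.card_insert_le w S; omega) (by
          rw [Finset.mem_insert, not_or]
          refine ⟨fun h => hw2 (by simp [h]), ?_⟩
          rwa [Finset.disjoint_singleton_right] at hSX)
      have h2 : (2 * ((2 * s + 2 : ℕ) : ℝ) + 1) / n = (4 * s + 5) / n := by push_cast; ring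
      rw [h2] at h1
      rw [Q_zero hm]
      unfold ind
      split_ifs
      · simpa using h1
      · simpa using he)
    s {u} v (by simp [add_comm]) (by simpa using hv'.symm) (by simpa using hv) (by simpa using hvv)
  refine le_trans ?_ this
  have : (s : ℝ) * ((2 * ((s + 1 : ℕ) + (({v'} : Finset (Vert m n)).card : ℝ)) + 1) / n)
      ≤ s * ((4 * s + 5) / n) := by
    have hs : (0 : ℝ) ≤ s := Nat.cast_nonneg s
    refine mul_le_mul_of_nonneg_left (div_le_div_of_nonneg_right ?_ hn'.le) hs
    rw [Finset.card_singleton]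
    push_cast
    linarith
  linarith

theorem avoidPair_le (a b : Fin m) (s : ℕ) (v v' : Vert m n) (ω : Config m n)
    (S : Finset (Vert m n)) :
    avoidPair a b s v' s ω S v ≤ walk ω (ind a) s v * walk ω (ind b) s v' :=
  avoidWalk_le_mul (ind_nonneg a) (walk_nonneg ω (ind_nonneg b) s v') (fun S u =>
    mul_le_mul_of_nonneg_left (by
      simpa using avoidWalk_le_mul (ω := ω) (F := fun _ _ v => ind b v) (ind_nonneg b)
        zero_le_one (fun S u => by simp) s (insert u S) v') (ind_nonneg a u)) s S v

/-- Both walks avoid `u` after their first step, so they are independent of the row that was used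
for it. -/
theorem pexp_avoidPair_mul (hm : 2 ≤ m) (a b : Fin m) (s : ℕ) (u v v' : Vert m n) :
    pexp (edgeWeight m n p α) (fun ω => transition (graph ω) u v * transition (graph ω) u v' *
        avoidPair a b s v' s ω {u} v)
      = pexp (edgeWeight m n p α)
          (fun ω => transition (graph ω) u v * transition (graph ω) u v') *
        pexp (edgeWeight m n p α) (fun ω => avoidPair a b s v' s ω {u} v) := by
  refine pexp_mul_of_dependsOn_of_disjoint (isLaw_edgeWeight hm) (s := rows {u})
    (fun x y h => ?_)
    (dependsOn_avoidWalk (fun S u _ => dependsOn_avoidPair_terminal a b s v' S u) s {u} v) ?_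
  · have h1 := dependsOn_transition u v h
    have h2 := dependsOn_transition u v' h
    simp only at h1 h2 ⊢
    rw [h1, h2]
  · rw [Set.disjoint_left]
    intro e he he'
    simp only [rows, Set.mem_ofPred_eq, Set.mem_singleton_iff] at he he'
    subst he
    simp at he'

/-- The error in the two-point estimate. -/
noncomputable def pairErr (n : ℕ) (p : ℝ) (s : ℕ) : ℝ :=
  2 * s * ((4 * s + 5) / n) + 5 / n + 2 / (n * p)

/-- Two walks from the same vertex are nearly independent under the annealed law. -/
theorem pexp_walk_mul_walk_ge (hm : 2 ≤ m) (hn : 1 ≤ n) (hp : Real.log n ≤ n * p)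
    (hp0 : 0 < (p : ℝ)) (a b : Fin m) (s : ℕ) (u : Vert m n) :
    Q (α : ℝ) (s + 1) (comm u) a * Q (α : ℝ) (s + 1) (comm u) b - pairErr n p s
      ≤ pexp (edgeWeight m n p α)
        (fun ω => walk ω (ind a) (s + 1) u * walk ω (ind b) (s + 1) u) := by
  classical
  have hw := isLaw_edgeWeight (n := n) (p := p) (α := α) hm
  have hn' : (0 : ℝ) < n := by exact_mod_cast hn
  set τ : Vert m n → Vert m n → ℝ := fun v v' => pexp (edgeWeight m n p α)
    (fun ω => transition (graph ω) u v * transition (graph ω) u v') with hτ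
  set e : ℝ := 2 * s * ((4 * s + 5) / n) with he
  have he0 : 0 ≤ e := by positivity
  have hτ0 : ∀ v v', 0 ≤ τ v v' := fun v v' => pexp_nonneg hw fun ω =>
    mul_nonneg (transition_nonneg _ _ _) (transition_nonneg _ _ _)
  have hτ1 : ∀ v, ∑ v', τ v v' = pexp (edgeWeight m n p α) (fun ω => transition (graph ω) u v) := by
    intro v
    rw [← pexp_sum]
    simp_rw [← Finset.mul_sum, transition_row_sum, mul_one]
  have hτ2 : ∀ v', ∑ v, τ v v'
      = pexp (edgeWeight m n p α) (fun ω => transition (graph ω) u v') := by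
    intro v
    rw [← pexp_sum]
    simp_rw [← Finset.sum_mul, transition_row_sum, one_mul]
  have hτ3 : ∑ v, ∑ v', τ v v' = 1 := by
    simp_rw [hτ1]
    exact sum_pexp_transition hm u
  have h1 := sum_pexp_transition_pair_ge (α := α) hm hn hp hp0 u
    (h := fun j => Q (α : ℝ) s j a) (h' := fun j => Q (α : ℝ) s j b)
    (fun j => Q_nonneg hm s j a) (fun j => Q_le_one hm s j a)
    (fun j => Q_nonneg hm s j b) (fun j => Q_le_one hm s j b)
  rw [← Q_succ hm, ← Q_succ hm] at h1
  have hexp : pexp (edgeWeight m n p α)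
        (fun ω => walk ω (ind a) (s + 1) u * walk ω (ind b) (s + 1) u)
      = ∑ v, ∑ v', pexp (edgeWeight m n p α) (fun ω => transition (graph ω) u v *
        transition (graph ω) u v' * (walk ω (ind a) s v * walk ω (ind b) s v')) := by
    simp_rw [← pexp_sum]
    congr 1
    funext ω
    simp only [walk]
    rw [Finset.sum_mul_sum]
    exact Finset.sum_congr rfl fun v _ => Finset.sum_congr rfl fun v' _ => by ring
  rw [hexp]
  -- Pairs that coincide after one step, or in which a walker is back at `u`, are bounded below by
  -- zero and paid for; on all others the avoiding pairs give the bound.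
  have hterm : ∀ v v', (if v = v' then 0 else
      τ v v' * (Q (α : ℝ) s (comm v) a * Q (α : ℝ) s (comm v') b)) - τ v v' * e
        - (if v = u then τ v v' else 0) - (if v' = u then τ v v' else 0)
      ≤ pexp (edgeWeight m n p α) (fun ω => transition (graph ω) u v *
        transition (graph ω) u v' * (walk ω (ind a) s v * walk ω (ind b) s v')) := by
    intro v v'
    have hpos : 0 ≤ pexp (edgeWeight m n p α) (fun ω => transition (graph ω) u v *
        transition (graph ω) u v' * (walk ω (ind a) s v * walk ω (ind b) s v')) :=
      pexp_nonneg hw fun ω => mul_nonneg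
        (mul_nonneg (transition_nonneg _ _ _) (transition_nonneg _ _ _))
        (mul_nonneg (walk_nonneg ω (ind_nonneg a) s v) (walk_nonneg ω (ind_nonneg b) s v'))
    have hq : Q (α : ℝ) s (comm v) a * Q (α : ℝ) s (comm v') b ≤ 1 :=
      mul_le_one₀ (Q_le_one hm s _ a) (Q_nonneg hm s _ b) (Q_le_one hm s _ b)
    have hte := mul_nonneg (hτ0 v v') he0
    have htq := mul_le_mul_of_nonneg_left hq (hτ0 v v')
    by_cases hvv : v = v'
    · have : 0 ≤ (if v = u then τ v v' else 0) := by
        split_ifs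
        · exact hτ0 v v'
        · exact le_rfl
      have : 0 ≤ (if v' = u then τ v v' else 0) := by
        split_ifs
        · exact hτ0 v v'
        · exact le_rfl
      rw [if_pos hvv]
      linarith
    by_cases hv : v = u
    · have : 0 ≤ (if v' = u then τ v v' else 0) := by
        split_ifs
        · exact hτ0 v v'
        · exact le_rfl
      rw [if_neg hvv, if_pos hv]
      linarith
    by_cases hv' : v' = u
    · rw [if_neg hvv, if_neg hv, if_pos hv']
      linarith
    rw [if_neg hvv, if_neg hv, if_neg hv', sub_zero, sub_zero]
    have h2 := pexp_avoidPair_ge (α := α) hm hn hp a b s hv hv' hvv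
    have h3 := mul_le_mul_of_nonneg_left h2 (hτ0 v v')
    have h4 : τ v v' * pexp (edgeWeight m n p α) (fun ω => avoidPair a b s v' s ω {u} v)
        ≤ pexp (edgeWeight m n p α) (fun ω => transition (graph ω) u v *
        transition (graph ω) u v' * (walk ω (ind a) s v * walk ω (ind b) s v')) := by
      rw [hτ]
      simp only
      rw [← pexp_avoidPair_mul hm]
      exact pexp_mono hw fun ω => mul_le_mul_of_nonneg_left (avoidPair_le a b s v v' ω {u})
        (mul_nonneg (transition_nonneg _ _ _) (transition_nonneg _ _ _))
    rw [← he] at h3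
    linarith
  refine le_trans ?_ (Finset.sum_le_sum fun v _ => Finset.sum_le_sum fun v' _ => hterm v v')
  simp only [Finset.sum_sub_distrib, ← Finset.sum_mul, hτ3]
  have e1 : ∑ v, ∑ v', (if v = u then τ v v' else 0) = ∑ v', τ u v' := by
    rw [Finset.sum_comm]
    simp
  have e2 : ∑ v, ∑ v', (if v' = u then τ v v' else 0) = ∑ v, τ v u := by simp
  rw [e1, e2, hτ1, hτ2]
  have h5 := pexp_transition_le (α := α) hm hn hp u u
  have h6 : pairErr n p s = e + 5 / n + 2 / (n * p) := rfl
  have h7 : (5 : ℝ) / n = 1 / n + 2 / n + 2 / n := by ring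
  rw [h6, h7]
  linarith

theorem pairErr_nonneg (n : ℕ) {p : ℝ} (hp : 0 ≤ p) (s : ℕ) : 0 ≤ pairErr n p s := by
  unfold pairErr; positivity

/-- The quenched law of the community at a fixed vertex concentrates in mean square. -/
theorem pexp_sq_sub_walk_le (hm : 2 ≤ m) (hn : 1 ≤ n) (hp : Real.log n ≤ n * p)
    (hp0 : 0 < (p : ℝ)) (i : Fin m) (s : ℕ) (u : Vert m n) :
    pexp (edgeWeight m n p α)
        (fun ω => (Q (α : ℝ) (s + 1) (comm u) i - walk ω (ind i) (s + 1) u) ^ 2)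
      ≤ 2 * (m : ℝ) ^ 2 * pairErr n p s := by
  have hw := isLaw_edgeWeight (n := n) (p := p) (α := α) hm
  set e := pairErr n p s
  have he : 0 ≤ e := pairErr_nonneg n hp0.le s
  set q : Fin m → ℝ := fun a => Q (α : ℝ) (s + 1) (comm u) a
  set E : Fin m → Fin m → ℝ := fun a b => pexp (edgeWeight m n p α)
    (fun ω => walk ω (ind a) (s + 1) u * walk ω (ind b) (s + 1) u)
  have hE : ∀ a b, q a * q b - e ≤ E a b := fun a b =>
    pexp_walk_mul_walk_ge hm hn hp hp0 a b s u
  have hq : ∑ a, q a = 1 := sum_Q hm _ _ _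
  have hq0 : 0 ≤ q i := Q_nonneg hm _ _ _
  have hq1 : q i ≤ 1 := Q_le_one hm _ _ _
  have hE1 : ∑ b, E i b = pexp (edgeWeight m n p α) (fun ω => walk ω (ind i) (s + 1) u) := by
    rw [← pexp_sum]
    simp_rw [← Finset.mul_sum, sum_walk_ind, mul_one]
  have hE2 : ∑ a, ∑ b, E a b = 1 := by
    simp_rw [E, ← pexp_sum, ← Finset.mul_sum, ← Finset.sum_mul, sum_walk_ind, mul_one]
    exact pexp_const hw 1
  have h1 : q i - m * e ≤ ∑ b, E i b := by
    calc q i - m * e = ∑ b, (q i * q b - e) := by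
          rw [Finset.sum_sub_distrib, ← Finset.mul_sum, hq]; simp
      _ ≤ _ := Finset.sum_le_sum fun b _ => hE i b
  -- Lower bounds become an upper bound: the excesses `E a b - q a * q b + e` are all nonnegative
  -- and add up to `m ^ 2 * e`, since both double sums equal one.
  have h2 : E i i - q i * q i + e ≤ (m : ℝ) ^ 2 * e := by
    have hnn : ∀ a b, 0 ≤ E a b - q a * q b + e := fun a b => by linarith [hE a b]
    calc E i i - q i * q i + e ≤ ∑ b, (E i b - q i * q b + e) :=
          Finset.single_le_sum (f := fun b => E i b - q i * q b + e) (fun b _ => hnn i b)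
            (Finset.mem_univ i)
      _ ≤ ∑ a, ∑ b, (E a b - q a * q b + e) :=
          Finset.single_le_sum (f := fun a => ∑ b, (E a b - q a * q b + e))
            (fun a _ => Finset.sum_nonneg fun b _ => hnn a b) (Finset.mem_univ i)
      _ = (m : ℝ) ^ 2 * e := by
          simp only [Finset.sum_add_distrib, Finset.sum_sub_distrib, hE2, ← Finset.mul_sum, hq,
            ← Finset.sum_mul, Finset.sum_const, Finset.card_univ, Fintype.card_fin, nsmul_eq_mul]
          ring
  have h3 : pexp (edgeWeight m n p α)
        (fun ω => (q i - walk ω (ind i) (s + 1) u) ^ 2)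
      = q i * q i - 2 * q i * ∑ b, E i b + E i i := by
    rw [hE1, ← pexp_const hw (q i * q i), ← pexp_const_mul, ← pexp_sub, ← pexp_add]
    congr 1
    funext ω
    ring
  rw [h3]
  have hm' : (2 : ℝ) ≤ m := by exact_mod_cast hm
  have h4 := mul_le_mul_of_nonneg_left h1 hq0
  have h5 : q i * (m * e) ≤ m * e := mul_le_of_le_one_left (by positivity) hq1
  have h6 : 2 * (m * e) ≤ m * m * e := by
    rw [mul_assoc]
    exact mul_le_mul_of_nonneg_right hm' (by positivity)
  nlinarith

open Classical in
/-- The vertices from which some community is reached with too small probability. -/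
noncomputable def badSet (ω : Config m n) (α : ℝ) (s : ℕ) (ε : ℝ) : Finset (Vert m n) :=
  Finset.univ.filter fun u => ∃ i, walk ω (ind i) s u < Q α s (comm u) i - ε

/-- Chebyshev at each vertex and community, then Markov for the number of bad vertices. -/
theorem prob_card_badSet_le (hm : 2 ≤ m) (hn : 1 ≤ n) (hp : Real.log n ≤ n * p)
    (hp0 : 0 < (p : ℝ)) (s : ℕ) {ε ρ : ℝ} (hε : 0 < ε) (hρ : 0 < ρ) :
    prob (edgeWeight m n p α) {ω | ρ * n ≤ ((badSet ω (α : ℝ) (s + 1) ε).card : ℝ)}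
      ≤ 2 * (m : ℝ) ^ 4 * pairErr n p s / (ε ^ 2 * ρ) := by
  classical
  have hw := isLaw_edgeWeight (n := n) (p := p) (α := α) hm
  have hn' : (0 : ℝ) < n := by exact_mod_cast hn
  have h1 : ∀ ω : Config m n, ((badSet ω (α : ℝ) (s + 1) ε).card : ℝ) ≤ ∑ u : Vert m n, ∑ i,
      (Q (α : ℝ) (s + 1) (comm u) i - walk ω (ind i) (s + 1) u) ^ 2 * (1 / ε ^ 2) := by
    intro ω
    unfold badSet
    rw [Finset.card_filter]
    push_cast
    refine Finset.sum_le_sum fun u _ => ?_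
    have hnn : ∀ i ∈ Finset.univ, 0 ≤
        (Q (α : ℝ) (s + 1) (comm u) i - walk ω (ind i) (s + 1) u) ^ 2 * (1 / ε ^ 2) :=
      fun i _ => by positivity
    split_ifs with h
    · obtain ⟨i, hi⟩ := h
      refine le_trans ?_ (Finset.single_le_sum hnn (Finset.mem_univ i))
      rw [mul_one_div, le_div_iff₀ (by positivity), one_mul]
      exact pow_le_pow_left₀ hε.le (by linarith) 2
    · exact Finset.sum_nonneg hnn
  refine (prob_le_div hw (fun ω => Nat.cast_nonneg _) (by positivity)).trans ?_
  have h2 : pexp (edgeWeight m n p α) (fun ω => ((badSet ω (α : ℝ) (s + 1) ε).card : ℝ))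
      ≤ ((m : ℝ) * n) * (m * (2 * (m : ℝ) ^ 2 * pairErr n p s * (1 / ε ^ 2))) := by
    refine (pexp_mono hw h1).trans ?_
    rw [pexp_sum]
    simp_rw [pexp_sum, pexp_mul_const]
    calc _ ≤ ∑ u : Vert m n, ∑ i : Fin m, 2 * (m : ℝ) ^ 2 * pairErr n p s * (1 / ε ^ 2) := by
          refine Finset.sum_le_sum fun u _ => Finset.sum_le_sum fun i _ => ?_
          exact mul_le_mul_of_nonneg_right (pexp_sq_sub_walk_le hm hn hp hp0 i s u) (by positivity)
      _ = _ := by simp [Fintype.card_prod]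
  calc _ ≤ ((m : ℝ) * n) * (m * (2 * (m : ℝ) ^ 2 * pairErr n p s * (1 / ε ^ 2))) / (ρ * n) := by
        gcongr
    _ = _ := by field_simp

end DBM

/-! ### Hitting probabilities and the killed walk -/

namespace DBM

open FinProd DigraphWalk

variable {m n : ℕ} {p α : unitInterval}

/-- Quenched probability that the walk from `u` visits `S` within `s` steps. -/
noncomputable def hit (ω : Config m n) (S : Finset (Vert m n)) : ℕ → Vert m n → ℝ
  | 0, u => if u ∈ S then 1 else 0
  | s + 1, u => if u ∈ S then 1 else ∑ v, transition (graph ω) u v * hit ω S s v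

theorem hit_nonneg (ω : Config m n) (S : Finset (Vert m n)) (s : ℕ) (u : Vert m n) :
    0 ≤ hit ω S s u := by
  induction s generalizing u with
  | zero => simp only [hit]; split_ifs <;> norm_num
  | succ s ih =>
    simp only [hit]
    split_ifs
    · exact zero_le_one
    · exact Finset.sum_nonneg fun v _ => mul_nonneg (transition_nonneg _ _ _) (ih v)

theorem sum_transition_mul_le_one (ω : Config m n) (u : Vert m n) {g : Vert m n → ℝ}
    (hg : ∀ v, g v ≤ 1) : ∑ v, transition (graph ω) u v * g v ≤ 1 := by
  rw [← transition_row_sum (graph ω) u]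
  exact Finset.sum_le_sum fun v _ => mul_le_of_le_one_right (transition_nonneg _ _ _) (hg v)

theorem hit_le_one (ω : Config m n) (S : Finset (Vert m n)) (s : ℕ) (u : Vert m n) :
    hit ω S s u ≤ 1 := by
  induction s generalizing u with
  | zero => simp only [hit]; split_ifs <;> norm_num
  | succ s ih =>
    simp only [hit]
    split_ifs
    · exact le_rfl
    · exact sum_transition_mul_le_one ω u ih

theorem hit_of_mem (ω : Config m n) {S : Finset (Vert m n)} (s : ℕ) {u : Vert m n} (hu : u ∈ S) :
    hit ω S s u = 1 := by
  cases s <;> simp [hit, hu]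

theorem hit_mono (ω : Config m n) {S S' : Finset (Vert m n)} (h : S ⊆ S') (s : ℕ) (u : Vert m n) :
    hit ω S s u ≤ hit ω S' s u := by
  by_cases hu' : u ∈ S'
  · rw [hit_of_mem ω s hu']
    exact hit_le_one _ _ _ _
  have hu : u ∉ S := fun h' => hu' (h h')
  induction s generalizing u with
  | zero => simp [hit, hu, hu']
  | succ s ih =>
    simp only [hit, if_neg hu, if_neg hu']
    refine Finset.sum_le_sum fun v _ => mul_le_mul_of_nonneg_left ?_ (transition_nonneg _ _ _)
    by_cases hv' : v ∈ S'
    · rw [hit_of_mem ω s hv']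
      exact hit_le_one _ _ _ _
    · exact ih v hv' fun h' => hv' (h h')

theorem dependsOn_hit (S : Finset (Vert m n)) (s : ℕ) (u : Vert m n) :
    DependsOn (fun ω : Config m n => hit ω S s u) (rows (S : Set (Vert m n))ᶜ) := by
  intro x y h
  induction s generalizing u with
  | zero => simp only [hit]
  | succ s ih =>
    simp only [hit]
    split_ifs with hu
    · rfl
    · refine Finset.sum_congr rfl fun v _ => ?_
      have h2 := ih v
      simp only at h2
      rw [transition_congr (fun l => h (u, l) (by simpa [rows] using hu)) v, h2]

/-- Visiting `S` and following a self-avoiding trajectory outside `S'` are disjoint events, so the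
lower bound for self-avoiding trajectories becomes an upper bound for hitting. -/
theorem hit_add_avoidWalk_le (ω : Config m n) {S S' : Finset (Vert m n)} (h : S ⊆ S') (s : ℕ)
    (u : Vert m n) : hit ω S s u + avoidWalk (fun _ _ _ => 1) s ω S' u ≤ 1 := by
  induction s generalizing S' u with
  | zero =>
    by_cases hu' : u ∈ S'
    · rw [avoidWalk_of_mem _ _ hu', add_zero]
      exact hit_le_one _ _ _ _
    · have hu : u ∉ S := fun h' => hu' (h h')
      simp [hit, avoidWalk, hu, hu']
  | succ s ih =>
    by_cases hu' : u ∈ S'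
    · rw [avoidWalk_of_mem _ _ hu', add_zero]
      exact hit_le_one _ _ _ _
    · simp only [hit, avoidWalk, if_neg hu', if_neg fun h' => hu' (h h')]
      rw [← Finset.sum_add_distrib]
      simp_rw [← mul_add]
      exact sum_transition_mul_le_one ω u fun v => ih (h.trans (Finset.subset_insert u S')) v

theorem pexp_hit_le (hm : 2 ≤ m) (hn : 1 ≤ n) (hp : Real.log n ≤ n * p) (N s : ℕ)
    (S : Finset (Vert m n)) (u : Vert m n) (hS : S.card + s ≤ N) (hu : u ∉ S) :
    pexp (edgeWeight m n p α) (fun ω => hit ω S s u) ≤ s * ((2 * N + 1) / n) := by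
  have hw := isLaw_edgeWeight (n := n) (p := p) (α := α) hm
  have h1 := pexp_avoidWalk_ge (α := α) hm hn hp (F := fun _ _ _ => 1)
    (fun _ _ u => zero_le_one) (fun S u _ => fun _ _ _ => rfl)
    (h := fun _ _ => 1) (fun _ _ => zero_le_one) (fun _ _ => le_rfl)
    (fun s j => by simp [sum_step hm]) ∅ N (e := 0) le_rfl (fun S u _ _ _ _ => by
      rw [pexp_const hw]; simp) s S u hS (Finset.disjoint_empty_right S) hu (Finset.notMem_empty u)
  have h2 := pexp_mono hw fun ω => hit_add_avoidWalk_le ω (Finset.Subset.refl S) s u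
  rw [pexp_add, pexp_const hw] at h2
  simp only [Finset.card_empty, Nat.cast_zero, add_zero, zero_add] at h1
  linarith

/-- Quenched probability that the walk from a uniform vertex visits `S` within `s` steps. -/
noncomputable def meanHit (ω : Config m n) (S : Finset (Vert m n)) (s : ℕ) : ℝ :=
  ∑ u, hit ω S s u * (1 / ((m : ℝ) * n))

theorem meanHit_nonneg (ω : Config m n) (S : Finset (Vert m n)) (s : ℕ) : 0 ≤ meanHit ω S s :=
  Finset.sum_nonneg fun u _ => mul_nonneg (hit_nonneg _ _ _ _) (by positivity)

theorem pexp_meanHit_le (hm : 2 ≤ m) (hn : 1 ≤ n) (hp : Real.log n ≤ n * p) (N s : ℕ)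
    (S : Finset (Vert m n)) (hS : S.card + s ≤ N) :
    pexp (edgeWeight m n p α) (fun ω => meanHit ω S s) ≤ (N + s * (2 * N + 1)) / n := by
  have hw := isLaw_edgeWeight (n := n) (p := p) (α := α) hm
  have hn' : (0 : ℝ) < n := by exact_mod_cast hn
  have hm' : (2 : ℝ) ≤ m := by exact_mod_cast hm
  unfold meanHit
  rw [pexp_sum]
  simp_rw [pexp_mul_const]
  have h1 : ∀ u, pexp (edgeWeight m n p α) (fun ω => hit ω S s u)
      ≤ (if u ∈ S then 1 else 0) + s * ((2 * N + 1) / n) := by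
    intro u
    split_ifs with hu
    · have := pexp_mono hw fun ω => hit_le_one ω S s u
      rw [pexp_const hw] at this
      have : (0 : ℝ) ≤ s * ((2 * N + 1) / n) := by positivity
      linarith
    · rw [zero_add]
      exact pexp_hit_le hm hn hp N s S u hS hu
  calc _ ≤ ∑ u, ((if u ∈ S then 1 else 0) + s * ((2 * N + 1) / n)) * (1 / ((m : ℝ) * n)) :=
        Finset.sum_le_sum fun u _ => mul_le_mul_of_nonneg_right (h1 u) (by positivity)
    _ = S.card * (1 / (m * n)) + s * ((2 * N + 1) / n) := by
        rw [← Finset.sum_mul, Finset.sum_add_distrib]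
        simp only [Finset.sum_ite_mem, Finset.univ_inter, Finset.sum_const, Finset.card_univ,
          Fintype.card_prod, Fintype.card_fin, nsmul_eq_mul, mul_one]
        push_cast
        field_simp
    _ ≤ N * (1 / n) + s * ((2 * N + 1) / n) := by
        gcongr
        · omega
        · nlinarith
    _ = _ := by ring

/-- All vertices are visited with small probability from a uniform starting point: moment bound.
The trajectories of `k` walks are revealed one after the other. -/
theorem pexp_mul_meanHit_pow_le (hm : 2 ≤ m) (hn : 1 ≤ n) (hp : Real.log n ≤ n * p)
    (x : Vert m n) (t N : ℕ) {δ : ℝ} (hδ : ((N + 1 + t : ℕ) + t * (2 * (N + 1 + t : ℕ) + 1)) / n ≤ δ) :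
    ∀ (k : ℕ) (R : Finset (Vert m n)) (A : Config m n → ℝ), (∀ ω, 0 ≤ A ω) →
      DependsOn A (rows (R : Set (Vert m n))) → R.card + k * (t + 1) ≤ N →
      pexp (edgeWeight m n p α) (fun ω => A ω * meanHit ω {x} t ^ k)
        ≤ δ ^ k * pexp (edgeWeight m n p α) A := by
  have hw := isLaw_edgeWeight (n := n) (p := p) (α := α) hm
  have hδ0 : 0 ≤ δ := le_trans (by positivity) hδ
  intro k
  induction k with
  | zero => intro R A _ _ _; simp
  | succ k ih =>
    -- One walk is revealed step by step: each transition is absorbed into the weight `A` and its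
    -- source into the revealed set `R`. Once the walk is at `x` or out of time, the induction
    -- hypothesis applies to the `k` remaining walks.
    have inner : ∀ (s : ℕ) (R : Finset (Vert m n)) (A : Config m n → ℝ) (u : Vert m n),
        (∀ ω, 0 ≤ A ω) → DependsOn A (rows (R : Set (Vert m n))) →
        R.card + s + k * (t + 1) ≤ N →
        pexp (edgeWeight m n p α) (fun ω => A ω * hit ω {x} s u * meanHit ω {x} t ^ k)
          ≤ δ ^ k * pexp (edgeWeight m n p α) (fun ω => A ω * hit ω {x} s u) := by
      intro s
      induction s with
      | zero =>
        intro R A u hA hAR hR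
        refine ih R _ (fun ω => mul_nonneg (hA ω) (hit_nonneg _ _ _ _)) (fun y z h => ?_) (by omega)
        simp only [hit]
        rw [hAR h]
      | succ s ihs =>
        intro R A u hA hAR hR
        by_cases hu : u ∈ ({x} : Finset (Vert m n))
        · simp only [hit_of_mem _ _ hu, mul_one]
          exact ih R A hA hAR (by omega)
        · have e1 : ∀ ω : Config m n, A ω * hit ω {x} (s + 1) u
              = ∑ v, A ω * transition (graph ω) u v * hit ω {x} s v := by
            intro ω
            simp only [hit, if_neg hu, Finset.mul_sum, mul_assoc]
          simp_rw [e1, Finset.sum_mul]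
          rw [pexp_sum, pexp_sum, Finset.mul_sum]
          refine Finset.sum_le_sum fun v _ => ?_
          refine ihs (insert u R) _ v (fun ω => mul_nonneg (hA ω) (transition_nonneg _ _ _))
            (fun y z h => ?_) (by have := Finset.card_insert_le u R; omega)
          rw [transition_congr (fun l => h (u, l) (by simp [rows])) v]
          rw [hAR fun e he => h e (by
            simp only [rows, Set.mem_ofPred_eq, Finset.coe_insert] at he ⊢
            exact Set.mem_insert_of_mem _ he)]
    intro R A hA hAR hR
    rw [add_mul, one_mul] at hR
    have h1 : pexp (edgeWeight m n p α) (fun ω => A ω * meanHit ω {x} t ^ (k + 1))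
        ≤ δ ^ k * pexp (edgeWeight m n p α) (fun ω => A ω * meanHit ω {x} t) := by
      have e1 : ∀ ω : Config m n, A ω * meanHit ω {x} t ^ (k + 1)
          = ∑ u, (A ω * hit ω {x} t u * meanHit ω {x} t ^ k) * (1 / ((m : ℝ) * n)) := by
        intro ω
        rw [pow_succ']
        generalize meanHit ω {x} t ^ k = M
        rw [meanHit, Finset.sum_mul, Finset.mul_sum]
        exact Finset.sum_congr rfl fun u _ => by ring
      have e2 : ∀ ω : Config m n, A ω * meanHit ω {x} t
          = ∑ u, (A ω * hit ω {x} t u) * (1 / ((m : ℝ) * n)) := by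
        intro ω
        rw [meanHit, Finset.mul_sum]
        exact Finset.sum_congr rfl fun u _ => by ring
      simp_rw [e1, e2]
      rw [pexp_sum, pexp_sum, Finset.mul_sum]
      refine Finset.sum_le_sum fun u _ => ?_
      rw [pexp_mul_const, pexp_mul_const, ← mul_assoc]
      exact mul_le_mul_of_nonneg_right (inner t R A u hA hAR (by omega)) (by positivity)
    -- Enlarging the target from `x` to `x` and all revealed vertices stops the fresh walk before it
    -- reads a revealed row, so it is independent of `A`.
    have h2 : pexp (edgeWeight m n p α) (fun ω => A ω * meanHit ω {x} t)
        ≤ pexp (edgeWeight m n p α) A * δ := by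
      have a1 : ∀ ω : Config m n, A ω * meanHit ω {x} t ≤ A ω * meanHit ω (insert x R) t := by
        intro ω
        refine mul_le_mul_of_nonneg_left (Finset.sum_le_sum fun u _ =>
          mul_le_mul_of_nonneg_right (hit_mono ω ?_ t u) (by positivity)) (hA ω)
        simp
      refine (pexp_mono hw a1).trans ?_
      rw [pexp_mul_of_dependsOn_of_disjoint hw hAR (B := fun ω => meanHit ω (insert x R) t)
        (t := rows ((insert x R : Finset (Vert m n)) : Set (Vert m n))ᶜ)]
      · refine mul_le_mul_of_nonneg_left ?_ (pexp_nonneg hw hA)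
        refine le_trans ?_ hδ
        refine pexp_meanHit_le hm hn hp (N + 1 + t) t _ ?_
        have := Finset.card_insert_le x R
        omega
      · intro y z h
        simp only [meanHit]
        refine Finset.sum_congr rfl fun u _ => ?_
        have := dependsOn_hit (insert x R) t u h
        simp only at this
        rw [this]
      · rw [Set.disjoint_left]
        intro e he he'
        simp only [rows, Set.mem_ofPred_eq, Set.mem_compl_iff, Finset.coe_insert] at he he'
        exact he' (Set.mem_insert_of_mem _ he)
    calc _ ≤ _ := h1
      _ ≤ δ ^ k * (pexp (edgeWeight m n p α) A * δ) :=
        mul_le_mul_of_nonneg_left h2 (pow_nonneg hδ0 k)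
      _ = _ := by ring

/-- Markov for the `k`-th power: with `k` of order `log n` and `δ / ρ` small, the bound beats the
union over the `m * n` vertices. -/
theorem prob_exists_meanHit_le (hm : 2 ≤ m) (hn : 1 ≤ n) (hp : Real.log n ≤ n * p) (t k : ℕ)
    {δ : ℝ} (hδ : ((k * (t + 1) + 1 + t : ℕ) + t * (2 * (k * (t + 1) + 1 + t : ℕ) + 1)) / n ≤ δ)
    {ρ : ℝ} (hρ : 0 < ρ) :
    prob (edgeWeight m n p α) {ω | ∃ x, ρ ≤ meanHit ω {x} t} ≤ m * n * (δ / ρ) ^ k := by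
  have hw := isLaw_edgeWeight (n := n) (p := p) (α := α) hm
  have h1 : {ω : Config m n | ∃ x, ρ ≤ meanHit ω {x} t} = ⋃ x, {ω | ρ ≤ meanHit ω {x} t} := by
    ext; simp
  rw [h1]
  refine (prob_iUnion_le hw _).trans ?_
  have h2 : ∀ x : Vert m n, prob (edgeWeight m n p α) {ω | ρ ≤ meanHit ω {x} t} ≤ (δ / ρ) ^ k := by
    intro x
    have h3 := pexp_mul_meanHit_pow_le (α := α) hm hn hp x t (k * (t + 1)) hδ k ∅ (fun _ => 1)
      (fun _ => zero_le_one) (fun _ _ _ => rfl) (by simp)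
    simp only [one_mul, pexp_const hw, mul_one] at h3
    have h4 : prob (edgeWeight m n p α) {ω | ρ ≤ meanHit ω {x} t}
        ≤ prob (edgeWeight m n p α) {ω | ρ ^ k ≤ meanHit ω {x} t ^ k} :=
      prob_mono hw fun ω hω => pow_le_pow_left₀ hρ.le hω k
    rw [div_pow]
    refine h4.trans ((prob_le_div hw (fun ω => pow_nonneg (meanHit_nonneg _ _ _) k)
      (by positivity)).trans ?_)
    gcongr
  calc _ ≤ ∑ x : Vert m n, (δ / ρ) ^ k := Finset.sum_le_sum fun x _ => h2 x
    _ = _ := by simp [Fintype.card_prod]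

/-! ### The walk killed at a vertex, and its bad set. -/

/-- The walk killed at `x`. -/
noncomputable def killed (ω : Config m n) (x : Vert m n) (g : Vert m n → ℝ) : ℕ → Vert m n → ℝ
  | 0, u => if u = x then 0 else g u
  | s + 1, u => if u = x then 0 else ∑ v, transition (graph ω) u v * killed ω x g s v

theorem dependsOn_killed (x : Vert m n) (g : Vert m n → ℝ) (s : ℕ) (u : Vert m n) :
    DependsOn (fun ω : Config m n => killed ω x g s u) (rows {x})ᶜ := by
  intro y z h
  induction s generalizing u with
  | zero => simp only [killed]
  | succ s ih =>
    simp only [killed]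
    split_ifs with hu
    · rfl
    · refine Finset.sum_congr rfl fun v _ => ?_
      have h2 := ih v
      simp only at h2
      rw [transition_congr (fun l => h (u, l) (by simpa [rows] using hu)) v, h2]

theorem killed_le_walk (ω : Config m n) (x : Vert m n) {g : Vert m n → ℝ} (hg : ∀ v, 0 ≤ g v)
    (s : ℕ) (u : Vert m n) : killed ω x g s u ≤ walk ω g s u := by
  induction s generalizing u with
  | zero =>
    simp only [killed, walk]
    split_ifs
    · exact hg u
    · exact le_rfl
  | succ s ih =>
    simp only [killed]
    split_ifs
    · exact walk_nonneg ω hg _ u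
    · exact Finset.sum_le_sum fun v _ =>
        mul_le_mul_of_nonneg_left (ih v) (transition_nonneg _ _ _)

/-- The two walks agree until the first visit to `x`. -/
theorem walk_le_killed_add_hit (ω : Config m n) (x : Vert m n) {g : Vert m n → ℝ}
    (hg : ∀ v, g v ≤ 1) (s : ℕ) (u : Vert m n) :
    walk ω g s u ≤ killed ω x g s u + hit ω {x} s u := by
  induction s generalizing u with
  | zero =>
    simp only [killed, walk, hit, Finset.mem_singleton]
    split_ifs
    · linarith [hg u]
    · simp
  | succ s ih =>
    by_cases hu : u = x
    · have h1 : ∀ v, walk ω g s v ≤ 1 := by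
        clear ih
        induction s with
        | zero => exact hg
        | succ s ih => exact fun v => sum_transition_mul_le_one ω v ih
      simp only [killed, walk, hit, Finset.mem_singleton, if_pos hu, zero_add]
      exact sum_transition_mul_le_one ω u h1
    · simp only [killed, walk, hit, Finset.mem_singleton, if_neg hu]
      rw [← Finset.sum_add_distrib]
      refine Finset.sum_le_sum fun v _ => ?_
      rw [← mul_add]
      exact mul_le_mul_of_nonneg_left (ih v) (transition_nonneg _ _ _)

open Classical in
/-- The vertices that are bad for the walk killed at `x`. -/
noncomputable def badOff (ω : Config m n) (x : Vert m n) (α : ℝ) (s : ℕ) (ε : ℝ) :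
    Finset (Vert m n) :=
  Finset.univ.filter fun u => ∃ i, killed ω x (ind i) s u < Q α s (comm u) i - ε

theorem dependsOn_badOff (x : Vert m n) (α : ℝ) (s : ℕ) (ε : ℝ) :
    DependsOn (fun ω : Config m n => badOff ω x α s ε) (rows {x})ᶜ := by
  intro y z h
  simp only [badOff]
  congr 1
  funext u
  congr 1
  funext i
  have := dependsOn_killed x (ind i) s u h
  simp only at this
  rw [this]

/-- A vertex bad at level `2 * ε` for the killed walk is bad at level `ε` for the true walk or hits
`x` with probability at least `ε`; the latter vertices are counted by Markov under the uniform
starting point. -/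
theorem card_badOff_le (ω : Config m n) (x : Vert m n) (α : ℝ) (s : ℕ) {ε : ℝ} (hε : 0 < ε) :
    ((badOff ω x α s (2 * ε)).card : ℝ)
      ≤ (badSet ω α s ε).card + (m * n) * meanHit ω {x} s / ε := by
  classical
  have h1 : badOff ω x α s (2 * ε)
      ⊆ badSet ω α s ε ∪ Finset.univ.filter (fun u => ε ≤ hit ω {x} s u) := by
    intro u hu
    simp only [badOff, badSet, Finset.mem_filter, Finset.mem_univ, true_and,
      Finset.mem_union] at hu ⊢
    obtain ⟨i, hi⟩ := hu
    by_contra hcon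
    push Not at hcon
    have h2 := walk_le_killed_add_hit ω x (g := ind i)
      (fun v => by unfold ind; split_ifs <;> norm_num) s u
    have := hcon.1 i
    linarith [hcon.2]
  have h2 : ((Finset.univ.filter (fun u => ε ≤ hit ω {x} s u)).card : ℝ)
      ≤ (m * n) * meanHit ω {x} s / ε := by
    rcases Nat.eq_zero_or_pos n with hn | hn
    · subst hn
      have : IsEmpty (Vert m 0) := inferInstance
      simp
    rcases Nat.eq_zero_or_pos m with hm | hm
    · subst hm
      have : IsEmpty (Vert 0 n) := inferInstance
      simp
    have hn' : (0 : ℝ) < n := by exact_mod_cast hn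
    have hm' : (0 : ℝ) < m := by exact_mod_cast hm
    have e : (m * n) * meanHit ω {x} s = ∑ u, hit ω {x} s u := by
      unfold meanHit
      rw [← Finset.sum_mul]
      field_simp
    rw [e, le_div_iff₀ hε, Finset.card_filter]
    push_cast
    rw [Finset.sum_mul]
    refine Finset.sum_le_sum fun u _ => ?_
    split_ifs with h
    · simpa using h
    · simpa using hit_nonneg _ _ _ _
  have h3 := (Finset.card_le_card h1).trans (Finset.card_union_le _ _)
  have h4 : ((badOff ω x α s (2 * ε)).card : ℝ) ≤ (badSet ω α s ε).card
      + ((Finset.univ.filter (fun u => ε ≤ hit ω {x} s u)).card : ℝ) := by exact_mod_cast h3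
  linarith

end DBM

/-! ### Large deviations for the first step -/

namespace DBM

open FinProd DigraphWalk

variable {m n : ℕ} {p α : unitInterval}

open Classical in
/-- If few edges from `x` lead to bad vertices or to the communities `F`, then the walk from `x`
reaches every community with nearly the right probability. -/
theorem walk_ge_of_edgesTo_lt (hm : 2 ≤ m) (ω : Config m n) (x : Vert m n) (F : Finset (Fin m))
    (s : ℕ) {ε η : ℝ} (hε : 0 ≤ ε) (i : Fin m)
    (hF : ∀ j, j ∉ F → Q (α : ℝ) (s + 1) (comm x) i - ε ≤ Q (α : ℝ) s j i)
    (h : edgesTo ω x (fun j l => j ∈ F ∨ (j, l) ∈ badOff ω x (α : ℝ) s (2 * ε)) < η * deg ω x) :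
    Q (α : ℝ) (s + 1) (comm x) i - (3 * ε + η) ≤ walk ω (ind i) (s + 1) x := by
  set B : Fin m → Fin n → Prop := fun j l => j ∈ F ∨ (j, l) ∈ badOff ω x (α : ℝ) s (2 * ε)
  set q := Q (α : ℝ) (s + 1) (comm x) i
  have hq1 : q ≤ 1 := Q_le_one hm _ _ _
  have h0 : 0 ≤ edgesTo ω x B := Finset.sum_nonneg fun l _ =>
    edgeVal_nonneg ω x (fun j => by split_ifs <;> norm_num) l
  -- The strict inequality in the hypothesis rules out a vertex without out-edges.
  have hd : 0 < deg ω x := by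
    refine lt_of_le_of_ne (deg_nonneg ω x) fun h' => ?_
    rw [← h', mul_zero] at h
    linarith
  -- An edge outside `B` loses `ε` from the community it reaches and `2 * ε` from the tolerance in
  -- `badOff`; an edge into `B` loses at most one.
  have h1 : (q - 3 * ε) * deg ω x - edgesTo ω x B
      ≤ ∑ l, edgeVal ω x (fun j => walk ω (ind i) s (j, l)) l := by
    unfold edgesTo deg
    rw [Finset.mul_sum, ← Finset.sum_sub_distrib]
    refine Finset.sum_le_sum fun l _ => ?_
    unfold edgeVal pres
    by_cases hp : (ω (x, l)).1 = true
    · simp only [if_pos hp]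
      have hw0 := walk_nonneg ω (ind_nonneg i) s (target (comm x) (ω (x, l)), l)
      by_cases hB : B (target (comm x) (ω (x, l))) l
      · rw [if_pos hB]
        linarith
      · rw [if_neg hB]
        rw [not_or] at hB
        have h2 := hF _ hB.1
        have h3 := hB.2
        simp only [badOff, Finset.mem_filter, Finset.mem_univ, true_and, not_exists, not_lt] at h3
        have h4 := h3 i
        have h5 := killed_le_walk ω x (ind_nonneg i) s (target (comm x) (ω (x, l)), l)
        simp only [comm] at h2 h4 h5 ⊢
        linarith
    · simp only [if_neg hp, mul_zero, sub_zero, le_refl]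
  have h2 : walk ω (ind i) (s + 1) x
      = (∑ l, edgeVal ω x (fun j => walk ω (ind i) s (j, l)) l) * (deg ω x)⁻¹ := by
    simp only [walk]
    rw [sum_transition_mul, if_neg hd.ne', zero_add]
  rw [h2, ← div_eq_mul_inv, le_div_iff₀ hd]
  linarith

/-- The shifted differences are nonnegative and add up to `m * c`, so none exceeds `m * c`. -/
theorem maxDev_le (hm : 2 ≤ m) (hn : 1 ≤ n) (ω : Config m n) (t : ℕ) {c : ℝ}
    (h : ∀ x i, Q (α : ℝ) t (comm x) i - c ≤ walk ω (ind i) t x) :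
    maxDev (α : ℝ) t ω ≤ m * c := by
  have : Nonempty (Fin m) := ⟨⟨0, by omega⟩⟩
  have : Nonempty (Fin n) := ⟨⟨0, by omega⟩⟩
  refine ciSup_le fun i => ciSup_le fun x => ?_
  rw [quenchedProb_eq_walk]
  have hnn : ∀ j, 0 ≤ walk ω (ind j) t x - Q (α : ℝ) t (comm x) j + c := fun j => by
    linarith [h x j]
  have h1 : walk ω (ind i) t x - Q (α : ℝ) t (comm x) i + c ≤ m * c := by
    calc _ ≤ ∑ j, (walk ω (ind j) t x - Q (α : ℝ) t (comm x) j + c) :=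
          Finset.single_le_sum
            (f := fun j => walk ω (ind j) t x - Q (α : ℝ) t (comm x) j + c)
            (fun j _ => hnn j) (Finset.mem_univ i)
      _ = m * c := by
          rw [Finset.sum_add_distrib, Finset.sum_sub_distrib, sum_walk_ind, sum_Q hm]
          simp
  have h2 := hnn i
  have hc : 0 ≤ c := by
    have : 0 ≤ m * c := h2.trans h1
    have hm' : (0 : ℝ) < m := by
      have : (2 : ℝ) ≤ m := by exact_mod_cast hm
      linarith
    exact nonneg_of_mul_nonneg_right this hm'
  have hm' : (1 : ℝ) ≤ m := by exact_mod_cast (by omega : 1 ≤ m)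
  rw [abs_le]
  constructor <;> nlinarith

open Classical in
/-- Out-edges of `x` are independent of the set of bad vertices of the walk killed at `x`. -/
theorem prob_badOff_le (hm : 2 ≤ m) (x : Vert m n) (F : Finset (Fin m)) (s : ℕ) {ε η θ ρ K : ℝ}
    (hθ : 0 ≤ θ) (hη : 0 < η) (hF : ∑ j, step (α : ℝ) (comm x) j * (if j ∈ F then 1 else 0) ≤ ρ) :
    prob (edgeWeight m n p α) {ω | ((badOff ω x (α : ℝ) s ε).card : ℝ) ≤ K ∧
        η * deg ω x ≤ edgesTo ω x (fun j l => j ∈ F ∨ (j, l) ∈ badOff ω x (α : ℝ) s ε)}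
      ≤ Real.exp (-(n * p * (1 - Real.exp (-θ))) + p * (Real.exp (θ / η) * (n * ρ + K))) := by
  have hw := isLaw_edgeWeight (n := n) (p := p) (α := α) hm
  set b := Real.exp (-(n * p * (1 - Real.exp (-θ))) + p * (Real.exp (θ / η) * (n * ρ + K)))
  -- Decompose over the value `B` of the bad set: `I B` does not read the row of `x`, and `J B`
  -- reads nothing else.
  let I : Finset (Vert m n) → Config m n → ℝ := fun B ω =>
    if badOff ω x (α : ℝ) s ε = B then 1 else 0
  let J : Finset (Vert m n) → Config m n → ℝ := fun B ω =>
    if η * deg ω x ≤ edgesTo ω x (fun j l => j ∈ F ∨ (j, l) ∈ B) then 1 else 0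
  have hI : ∀ B, DependsOn (I B) (rows {x})ᶜ := fun B y z h => by
    simp only [I]
    have h1 := dependsOn_badOff x (α : ℝ) s ε h
    simp only at h1
    rw [h1]
  have hJ : ∀ B, DependsOn (J B) (rows {x}) := fun B y z h => by
    have h1 : ∀ l, y (x, l) = z (x, l) := fun l => h (x, l) rfl
    have h2 : edgesTo y x (fun j l => j ∈ F ∨ (j, l) ∈ B)
        = edgesTo z x (fun j l => j ∈ F ∨ (j, l) ∈ B) := by
      unfold edgesTo edgeVal
      simp only [h1]
    simp only [J]
    rw [deg_congr h1, h2]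
  have hJb : ∀ B : Finset (Vert m n), (B.card : ℝ) ≤ K → pexp (edgeWeight m n p α) (J B) ≤ b := by
    intro B hB
    refine (prob_edgesTo_le (α := α) hm x (fun j l => j ∈ F ∨ (j, l) ∈ B) hθ hη).trans ?_
    refine Real.exp_le_exp.2 (add_le_add le_rfl (mul_le_mul_of_nonneg_left
      (mul_le_mul_of_nonneg_left ?_ (Real.exp_pos _).le) p.2.1))
    calc ∑ l : Fin n, ∑ j, step (α : ℝ) (comm x) j * (if j ∈ F ∨ (j, l) ∈ B then 1 else 0)
        ≤ ∑ l : Fin n, (∑ j, step (α : ℝ) (comm x) j * (if j ∈ F then 1 else 0)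
            + ∑ j : Fin m, if (j, l) ∈ B then 1 else 0) := by
          refine Finset.sum_le_sum fun l _ => ?_
          rw [← Finset.sum_add_distrib]
          refine Finset.sum_le_sum fun j _ => ?_
          have h1 := step_nonneg hm α.2.1 α.2.2 (comm x) j
          have h2 := step_le_one hm α.2.1 α.2.2 (comm x) j
          by_cases a1 : j ∈ F <;> by_cases a2 : (j, l) ∈ B <;> simp [a1, a2, h2]
      _ ≤ ∑ l : Fin n, (ρ + ∑ j : Fin m, if (j, l) ∈ B then 1 else 0) :=
          Finset.sum_le_sum fun l _ => add_le_add hF le_rfl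
      _ = n * ρ + B.card := by
          rw [Finset.sum_add_distrib]
          congr 1
          · simp
          · rw [← Fintype.sum_prod_type_right (f := fun v => if v ∈ B then (1 : ℝ) else 0)]
            simp
      _ ≤ n * ρ + K := by linarith
  have h1 : prob (edgeWeight m n p α) {ω | ((badOff ω x (α : ℝ) s ε).card : ℝ) ≤ K ∧
        η * deg ω x ≤ edgesTo ω x (fun j l => j ∈ F ∨ (j, l) ∈ badOff ω x (α : ℝ) s ε)}
      ≤ ∑ B ∈ Finset.univ.filter (fun B : Finset (Vert m n) => (B.card : ℝ) ≤ K),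
        pexp (edgeWeight m n p α) (fun ω => I B ω * J B ω) := by
    rw [← pexp_sum]
    have hnn : ∀ B ω, 0 ≤ I B ω * J B ω := fun B ω =>
      mul_nonneg (by simp only [I]; split_ifs <;> norm_num)
        (by simp only [J]; split_ifs <;> norm_num)
    refine prob_le_pexp hw (fun ω => Finset.sum_nonneg fun B _ => hnn B ω) fun ω hω => ?_
    refine le_trans ?_ (Finset.single_le_sum (f := fun B => I B ω * J B ω) (fun B _ => hnn B ω)
      (a := badOff ω x (α : ℝ) s ε) (by simpa using hω.1))
    simp only [I, J, if_true, one_mul]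
    rw [if_pos hω.2]
  refine h1.trans ?_
  calc ∑ B ∈ Finset.univ.filter (fun B : Finset (Vert m n) => (B.card : ℝ) ≤ K),
        pexp (edgeWeight m n p α) (fun ω => I B ω * J B ω)
      ≤ ∑ B ∈ Finset.univ.filter (fun B : Finset (Vert m n) => (B.card : ℝ) ≤ K),
        pexp (edgeWeight m n p α) (I B) * b := by
        refine Finset.sum_le_sum fun B hB => ?_
        rw [pexp_mul_of_dependsOn_of_disjoint hw (hI B) (hJ B) disjoint_compl_left]
        exact mul_le_mul_of_nonneg_left (hJb B (by simpa using hB))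
          (pexp_nonneg hw fun ω => by simp only [I]; split_ifs <;> norm_num)
    _ ≤ ∑ B : Finset (Vert m n), pexp (edgeWeight m n p α) (I B) * b :=
        Finset.sum_le_sum_of_subset_of_nonneg (Finset.filter_subset _ _) fun B _ _ =>
          mul_nonneg (pexp_nonneg hw fun ω => by simp only [I]; split_ifs <;> norm_num)
            (Real.exp_pos _).le
    _ = b := by
        rw [← Finset.sum_mul, ← pexp_sum]
        have : ∀ ω, ∑ B, I B ω = 1 := fun ω => by simp [I]
        simp_rw [this]
        rw [pexp_const hw, one_mul]

/-! ### Effect of the first step on the community chain. -/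

/-- The nontrivial eigenvalue of the community process. -/
noncomputable def eig (m : ℕ) (α : ℝ) : ℝ := 1 - (m : ℝ) / ((m : ℝ) - 1) * α

theorem Q_sub_Q (hm : 2 ≤ m) (α : ℝ) (s : ℕ) (c j i : Fin m) :
    Q α (s + 1) c i - Q α s j i = eig m α ^ s * ((if c = i then 1 else 0) * eig m α
      - (if j = i then 1 else 0) + (1 - eig m α) / m) := by
  have h : (2 : ℝ) ≤ m := by exact_mod_cast hm
  have h3 : (m : ℝ) ≠ 0 := by linarith
  unfold Q
  change (1 + _ * eig m α ^ (s + 1)) / (m : ℝ) - (1 + _ * eig m α ^ s) / m = _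
  rw [pow_succ]
  field_simp
  ring

theorem abs_eig_le_one (hm : 2 ≤ m) : |eig m α| ≤ 1 := by
  have h : (2 : ℝ) ≤ m := by exact_mod_cast hm
  have h1 : (m : ℝ) / ((m : ℝ) - 1) ≤ 2 := by
    rw [div_le_iff₀ (by linarith)]; linarith
  have h2 : 0 ≤ (m : ℝ) / ((m : ℝ) - 1) := div_nonneg (by linarith) (by linarith)
  have := α.2.1
  have := α.2.2
  unfold eig
  rw [abs_le]
  constructor <;> nlinarith

/-- Outside of an unlikely set of communities, the first step is nearly irrelevant. -/
theorem exists_unlikely (hm : 2 ≤ m) (s : ℕ) {ε ρ : ℝ} (hρ0 : 0 ≤ ρ) (hρ : 2 * ρ ≤ ε)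
    (h : (α : ℝ) ≤ ρ ∨ (m = 2 ∧ 1 - (α : ℝ) ≤ ρ) ∨ 2 * |eig m α| ^ s ≤ ε) (c : Fin m) :
    ∃ F : Finset (Fin m), ∑ j, step (α : ℝ) c j * (if j ∈ F then 1 else 0) ≤ ρ ∧
      ∀ i j, j ∉ F → Q (α : ℝ) (s + 1) c i - ε ≤ Q (α : ℝ) s j i := by
  have hm' : (2 : ℝ) ≤ m := by exact_mod_cast hm
  have he := abs_eig_le_one (α := α) hm
  have hes : |eig m α ^ s| ≤ 1 := by
    rw [abs_pow]
    exact pow_le_one₀ (abs_nonneg _) he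
  have key : ∀ {i j : Fin m} {y : ℝ}, |(if c = i then (1 : ℝ) else 0) * eig m α
      - (if j = i then 1 else 0) + (1 - eig m α) / m| ≤ y →
      Q (α : ℝ) (s + 1) c i - Q (α : ℝ) s j i ≤ |eig m α| ^ s * y := by
    intro i j y hy
    rw [Q_sub_Q hm]
    refine (le_abs_self _).trans ?_
    rw [abs_mul, abs_pow]
    exact mul_le_mul_of_nonneg_left hy (pow_nonneg (abs_nonneg _) s)
  have hpow : |eig m α| ^ s ≤ 1 := pow_le_one₀ (abs_nonneg _) he
  have hα0 := α.2.1
  have hα1 := α.2.2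
  have hinv : (1 : ℝ) / m ≤ 1 / 2 := by gcongr
  have hinv0 : (0 : ℝ) < 1 / m := by positivity
  rw [abs_le] at he
  rcases h with h | ⟨h2, h⟩ | h
  -- Rewiring is rare: leaving the community is unlikely, and one step of the chain changes `Q` by
  -- at most `2 * α`.
  · refine ⟨Finset.univ.erase c, ?_, fun i j hj => ?_⟩
    · have e1 : ∀ j, step (α : ℝ) c j * (if j ∈ Finset.univ.erase c then (1 : ℝ) else 0)
          = step (α : ℝ) c j - (if j = c then 1 - (α : ℝ) else 0) := by
        intro j
        by_cases hj : j = c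
        · simp [hj, step]
        · simp [hj]
      simp_rw [e1]
      rw [Finset.sum_sub_distrib, sum_step hm]
      simpa using h
    · have hjc : j = c := by simpa using hj
      subst hjc
      have h1 : 1 - eig m α ≤ 2 * α := by
        unfold eig
        have : (m : ℝ) / ((m : ℝ) - 1) ≤ 2 := by
          rw [div_le_iff₀ (by linarith)]; linarith
        nlinarith
      have h3 := key (i := i) (j := j) (y := 2 * α) (by
        have h4 : (1 - eig m α) / m ≤ 1 - eig m α := div_le_self (by linarith) (by linarith)
        have h5 : 0 ≤ (1 - eig m α) / m := div_nonneg (by linarith) (by linarith)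
        rw [abs_le]
        split_ifs <;> constructor <;> linarith)
      have h4 : |eig m α| ^ s * (2 * α) ≤ 2 * α := mul_le_of_le_one_left (by positivity) hpow
      linarith
  -- Two communities and nearly certain rewiring: staying is unlikely, and from the other community
  -- the remaining `s` steps have nearly the law of `s + 1` steps from `c`.
  · refine ⟨{c}, ?_, fun i j hj => ?_⟩
    · simpa [step] using h
    · have hjc : j ≠ c := by simpa using hj
      subst h2
      have he2 : eig 2 α = 1 - 2 * α := by unfold eig; norm_num
      have h3 := key (i := i) (j := j) (y := 2 * (1 - α)) (by
        rw [he2]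
        push_cast
        have h6 : (if c = i then (1 : ℝ) else 0) = 1 - (if j = i then 1 else 0) := by
          have : j = i ↔ ¬ c = i := by omega
          by_cases hc : c = i <;> simp [this, hc]
        rw [h6, abs_le]
        split_ifs <;> constructor <;> linarith)
      have h4 : |eig 2 α| ^ s * (2 * (1 - α)) ≤ 2 * (1 - α) :=
        mul_le_of_le_one_left (by linarith) hpow
      linarith
  -- The chain has mixed: no community is excluded.
  · refine ⟨∅, by simpa using hρ0, fun i j _ => ?_⟩
    have h3 := key (i := i) (j := j) (y := 2) (by
      have h5 : 0 ≤ (1 - eig m α) / m := div_nonneg (by linarith) (by linarith)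
      have h4 : (1 - eig m α) / m ≤ (1 - eig m α) / 2 := by gcongr; linarith
      rw [abs_le]
      split_ifs <;> constructor <;> linarith)
    linarith

/-- The eigenvalue is near `1` only for small `α`, and near `-1` only when `m = 2` and `α` is near
`1`: for `m ≥ 3` it is at least `-1 / 2`, hence the condition `ρ ≤ 1 / 2`. -/
theorem abs_eig_le (hm : 2 ≤ m) {ρ : ℝ} (hρ : ρ ≤ 1 / 2) (h1 : ρ < α)
    (h2 : m = 2 → ρ < 1 - (α : ℝ)) : |eig m α| ≤ 1 - ρ := by
  have hm' : (2 : ℝ) ≤ m := by exact_mod_cast hm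
  have hα0 := α.2.1
  have hα1 := α.2.2
  unfold eig
  have h3 : 1 ≤ (m : ℝ) / ((m : ℝ) - 1) := by
    rw [le_div_iff₀ (by linarith)]; linarith
  rw [abs_le]
  constructor
  · rcases eq_or_ne m 2 with h | h
    · have := h2 h
      subst h
      norm_num
      linarith
    · have hm3 : (3 : ℝ) ≤ m := by exact_mod_cast (by omega : 3 ≤ m)
      have : (m : ℝ) / ((m : ℝ) - 1) ≤ 3 / 2 := by
        rw [div_le_iff₀ (by linarith)]; linarith
      nlinarith
  · nlinarith

/-- The quantitative form of the theorem. -/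
theorem prob_maxDev_le (hm : 2 ≤ m) (hn : 1 ≤ n) (hp : Real.log n ≤ n * p)
    (hp0 : 0 < (p : ℝ)) (s k : ℕ) {ε ρ θ δ : ℝ} (hε : 0 < ε) (hρ0 : 0 < ρ) (hρ : 2 * ρ ≤ ε)
    (hθ : 0 ≤ θ)
    (hδ : ((k * (s + 1 + 1) + 1 + (s + 1) : ℕ)
      + (s + 1 : ℕ) * (2 * (k * (s + 1 + 1) + 1 + (s + 1) : ℕ) + 1)) / n ≤ δ)
    (h : (α : ℝ) ≤ ρ ∨ (m = 2 ∧ 1 - (α : ℝ) ≤ ρ) ∨ 2 * |eig m α| ^ (s + 1) ≤ ε) :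
    prob (edgeWeight m n p α) {ω | m * (4 * ε) < maxDev (α : ℝ) (s + 2) ω}
      ≤ 2 * (m : ℝ) ^ 4 * pairErr n p s / (ε ^ 2 * ρ) + m * n * (δ / (ρ * ε / m)) ^ k
        + m * n * Real.exp (-(n * p * (1 - Real.exp (-θ) - 3 * ρ * Real.exp (θ / ε)))) := by
  classical
  have hw := isLaw_edgeWeight (n := n) (p := p) (α := α) hm
  have hm' : (2 : ℝ) ≤ m := by exact_mod_cast hm
  have hn' : (0 : ℝ) < n := by exact_mod_cast hn
  choose F hF1 hF2 using fun c => exists_unlikely (α := α) hm (s + 1) hρ0.le hρ h c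
  let E₁ : Set (Config m n) := {ω | ρ * n ≤ ((badSet ω (α : ℝ) (s + 1) ε).card : ℝ)}
  let E₂ : Set (Config m n) := {ω | ∃ x, ρ * ε / m ≤ meanHit ω {x} (s + 1)}
  -- Off `E₁` and `E₂` the bad set for the killed walk has at most `ρ * n + ρ * n` elements, the
  -- threshold in `E₂` being chosen for this. With `ρ` for the communities in `F`, the density is at
  -- most `3 * ρ`.
  let E₃ : Vert m n → Set (Config m n) := fun x =>
    {ω | ((badOff ω x (α : ℝ) (s + 1) (2 * ε)).card : ℝ) ≤ 2 * ρ * n ∧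
      ε * deg ω x ≤ edgesTo ω x
        (fun j l => j ∈ F (comm x) ∨ (j, l) ∈ badOff ω x (α : ℝ) (s + 1) (2 * ε))}
  have hsub : {ω | m * (4 * ε) < maxDev (α : ℝ) (s + 2) ω} ⊆ (E₁ ∪ E₂) ∪ ⋃ x, E₃ x := by
    intro ω hω
    by_contra hcon
    simp only [Set.mem_union, Set.mem_iUnion, not_or, not_exists] at hcon
    obtain ⟨⟨h1, h2⟩, h3⟩ := hcon
    have h1' : ((badSet ω (α : ℝ) (s + 1) ε).card : ℝ) < ρ * n := not_le.1 h1
    have h2' : ∀ x, meanHit ω {x} (s + 1) < ρ * ε / m := fun x =>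
      not_le.1 fun h' => h2 ⟨x, h'⟩
    refine absurd hω (not_lt.2 (maxDev_le hm hn ω (s + 2) fun x i => ?_))
    have h4 : ((badOff ω x (α : ℝ) (s + 1) (2 * ε)).card : ℝ) ≤ 2 * ρ * n := by
      refine (card_badOff_le ω x (α : ℝ) (s + 1) hε).trans ?_
      have h5 : (m * n) * meanHit ω {x} (s + 1) / ε ≤ (m * n) * (ρ * ε / m) / ε := by
        gcongr
        exact (h2' x).le
      have h6 : ((m : ℝ) * n) * (ρ * ε / m) / ε = ρ * n := by
        field_simp
      linarith
    have h7 := not_le.1 fun h' => h3 x ⟨h4, h'⟩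
    have h8 := walk_ge_of_edgesTo_lt hm ω x (F (comm x)) (s + 1) hε.le i
      (hF2 (comm x) i) h7
    have h9 : 3 * ε + ε = 4 * ε := by ring
    rwa [h9] at h8
  have b1 : prob (edgeWeight m n p α) E₁ ≤ 2 * (m : ℝ) ^ 4 * pairErr n p s / (ε ^ 2 * ρ) :=
    prob_card_badSet_le hm hn hp hp0 s hε hρ0
  have b2 : prob (edgeWeight m n p α) E₂ ≤ m * n * (δ / (ρ * ε / m)) ^ k :=
    prob_exists_meanHit_le hm hn hp (s + 1) k hδ (by positivity)
  have b3 : prob (edgeWeight m n p α) (⋃ x, E₃ x)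
      ≤ m * n * Real.exp (-(n * p * (1 - Real.exp (-θ) - 3 * ρ * Real.exp (θ / ε)))) := by
    refine (prob_iUnion_le hw _).trans ?_
    calc ∑ x, prob (edgeWeight m n p α) (E₃ x)
        ≤ ∑ x : Vert m n, Real.exp (-(n * p * (1 - Real.exp (-θ) - 3 * ρ * Real.exp (θ / ε)))) := by
          refine Finset.sum_le_sum fun x _ => ?_
          refine (prob_badOff_le (α := α) hm x (F (comm x)) (s + 1) hθ hε
            (hF1 (comm x))).trans (le_of_eq ?_)
          congr 1
          ring
      _ = _ := by simp [Fintype.card_prod]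
  refine (prob_mono hw hsub).trans ((prob_union_le hw _ _).trans ?_)
  have := prob_union_le hw E₁ E₂
  linarith

end DBM

/-! ### Asymptotics -/

namespace DBM

/-- The choice of the parameters in the large deviation bound. -/
theorem exists_params {a ε : ℝ} (ha : 1 < a) (hε : 0 < ε) :
    ∃ θ ρ γ : ℝ, 0 ≤ θ ∧ 0 < ρ ∧ ρ ≤ 1 / 2 ∧ 2 * ρ ≤ ε ∧ 0 < γ ∧
      1 + γ ≤ a * (1 - Real.exp (-θ) - 3 * ρ * Real.exp (θ / ε)) := by
  have ha0 : 0 < a := by linarith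
  have h1 : 0 < 1 - 1 / a := by
    rw [sub_pos, div_lt_one ha0]; exact ha
  have h1a : 0 < 1 / a := by positivity
  -- The two losses take one half and at most one quarter of `1 - 1 / a`; multiplied by `a`, what
  -- remains is at least `1 + (a - 1) / 4`.
  obtain ⟨θ, hθ⟩ : ∃ θ, θ = -Real.log ((1 - 1 / a) / 2) := ⟨_, rfl⟩
  have hexp : Real.exp (-θ) = (1 - 1 / a) / 2 := by
    rw [hθ, neg_neg, Real.exp_log (by linarith)]
  have hE := Real.exp_pos (θ / ε)
  obtain ⟨ρ, hρ⟩ : ∃ ρ, ρ = min (1 / 2) (min (ε / 2) ((1 - 1 / a) / (12 * Real.exp (θ / ε)))) :=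
    ⟨_, rfl⟩
  have r1 : ρ ≤ 1 / 2 := hρ ▸ min_le_left _ _
  have r2 : ρ ≤ ε / 2 := hρ ▸ (min_le_right _ _).trans (min_le_left _ _)
  have r3 : ρ ≤ (1 - 1 / a) / (12 * Real.exp (θ / ε)) :=
    hρ ▸ (min_le_right _ _).trans (min_le_right _ _)
  refine ⟨θ, ρ, (a - 1) / 4, ?_, ?_, r1, by linarith, by linarith, ?_⟩
  · rw [hθ, neg_nonneg]
    exact Real.log_nonpos (by linarith) (by linarith)
  · rw [hρ]
    exact lt_min (by norm_num) (lt_min (by linarith) (by positivity))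
  · rw [le_div_iff₀ (by positivity)] at r3
    rw [hexp]
    have h2 : 3 * ρ * Real.exp (θ / ε) ≤ (1 - 1 / a) / 4 := by linarith
    have h3 : a * (1 / a) = 1 := by field_simp
    have h4 := mul_le_mul_of_nonneg_left h2 ha0.le
    nlinarith

theorem pairErr_le {n t : ℕ} (hn : 1 ≤ n) {p L : ℝ} (ht : 2 ≤ t) (hL : (t : ℝ) ^ 2 / n ≤ L)
    (hn' : 1 / (n : ℝ) ≤ L) (hp : 1 / (n * p) ≤ L) : pairErr n p (t - 2) ≤ 15 * L := by
  have h0 : (0 : ℝ) < n := by exact_mod_cast hn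
  have hs : ((t - 2 : ℕ) : ℝ) = t - 2 := by rw [Nat.cast_sub ht]; norm_num
  have ht' : (2 : ℝ) ≤ t := by exact_mod_cast ht
  unfold pairErr
  rw [hs]
  have h1 : 2 * ((t : ℝ) - 2) * ((4 * (t - 2) + 5) / n) ≤ 8 * ((t : ℝ) ^ 2 / n) := by
    rw [← mul_div_assoc, ← mul_div_assoc]
    refine div_le_div_of_nonneg_right ?_ h0.le
    nlinarith
  have h2 : (5 : ℝ) / n = 5 * (1 / n) := by ring
  have h3 : (2 : ℝ) / (n * p) = 2 * (1 / (n * p)) := by ring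
  linarith

/-- Up to constants, `k` walks reveal `k * t` vertices, and a fresh walk has `t` chances to hit one
of them. -/
theorem hitErr_le {n t k : ℕ} (hn : 1 ≤ n) (ht : 2 ≤ t) :
    ((k * (t - 2 + 1 + 1) + 1 + (t - 2 + 1) : ℕ)
      + (t - 2 + 1 : ℕ) * (2 * (k * (t - 2 + 1 + 1) + 1 + (t - 2 + 1) : ℕ) + 1)) / (n : ℝ)
      ≤ 4 * (k + 1) * ((t : ℝ) ^ 2 / n) := by
  obtain ⟨s, rfl⟩ := Nat.exists_eq_add_of_le ht
  have h0 : (0 : ℝ) < n := by exact_mod_cast hn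
  have h1 : 2 + s - 2 = s := by omega
  rw [h1, ← mul_div_assoc]
  gcongr
  push_cast
  have hs : (0 : ℝ) ≤ s := Nat.cast_nonneg s
  have hk : (0 : ℝ) ≤ k := Nat.cast_nonneg k
  have hks : (0 : ℝ) ≤ k * s := mul_nonneg hk hs
  nlinarith [mul_nonneg hks hs, mul_nonneg hs hs]

theorem tendsto_log_natCast : Tendsto (fun n : ℕ => Real.log (n : ℝ)) atTop atTop :=
  Real.tendsto_log_atTop.comp tendsto_natCast_atTop_atTop

end DBM

theorem proposition8
    (m : ℕ → ℕ) (hm : ∀ n, 2 ≤ m n) (M : ℕ) (hM : ∀ n, m n ≤ M)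
    (lam : ℕ → ℝ) (a b : ℝ) (ha : 1 < a) (hlam : ∀ n, a ≤ lam n ∧ lam n ≤ b)
    (p : ℕ → unitInterval) (hp : ∀ᶠ n : ℕ in atTop, (p n : ℝ) = lam n * Real.log n / n)
    (α : ℕ → unitInterval)
    (t : ℕ → ℕ) (ht : Tendsto t atTop atTop)
    (ht' : (fun n : ℕ => (t n : ℝ)) =o[atTop]
      (fun n : ℕ => Real.sqrt (n : ℝ) / (Real.log (n : ℝ)) ^ 2)) :
    ∀ ε : ℝ, 0 < ε →
      Tendsto
        (fun n : ℕ => DBM.law (m n) n (p n) (α n)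
          {ω | ε < DBM.maxDev (α n : ℝ) (t n) ω})
        atTop (𝓝 0) := by
  intro ε₀ hε₀
  have hM2 : (2 : ℝ) ≤ M := by exact_mod_cast (hm 0).trans (hM 0)
  obtain ⟨ε, hεdef⟩ : ∃ ε, ε = ε₀ / (4 * M) := ⟨_, rfl⟩
  have hε : 0 < ε := by rw [hεdef]; positivity
  have hεM : M * (4 * ε) = ε₀ := by rw [hεdef]; field_simp
  obtain ⟨θ, ρ, γ, hθ, hρ0, hρ1, hρ2, hγ, hγa⟩ := DBM.exists_params ha hε
  have hfin : ∀ n, DBM.law (m n) n (p n) (α n) {ω | ε₀ < DBM.maxDev (α n : ℝ) (t n) ω} ≠ ⊤ := by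
    intro n
    have := DBM.isProbabilityMeasure_law (m n) n (hm n) (p n) (α n)
    exact measure_ne_top _ _
  rw [← ENNReal.tendsto_toReal_iff hfin ENNReal.zero_ne_top, ENNReal.toReal_zero]
  -- The three terms bound the probabilities of too many bad vertices, of a vertex that is hit too
  -- often, and of an atypical first step.
  let U : ℕ → ℝ := fun n => 2 * (M : ℝ) ^ 4 * (15 * (Real.log n)⁻¹) / (ε ^ 2 * ρ)
    + M * (n : ℝ)⁻¹ + M * Real.exp (-(γ * Real.log n))
  have hlog := DBM.tendsto_log_natCast
  have hU : Tendsto U atTop (𝓝 0) := by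
    have h1 : Tendsto (fun n : ℕ => (Real.log (n : ℝ))⁻¹) atTop (𝓝 0) :=
      tendsto_inv_atTop_zero.comp hlog
    have h2 : Tendsto (fun n : ℕ => (n : ℝ)⁻¹) atTop (𝓝 0) :=
      tendsto_inv_atTop_zero.comp tendsto_natCast_atTop_atTop
    have h3 : Tendsto (fun n : ℕ => Real.exp (-(γ * Real.log n))) atTop (𝓝 0) :=
      Real.tendsto_exp_neg_atTop_nhds_zero.comp (hlog.const_mul_atTop hγ)
    have := ((((h1.const_mul 15).const_mul (2 * (M : ℝ) ^ 4)).div_const (ε ^ 2 * ρ)).add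
      (h2.const_mul (M : ℝ))).add (h3.const_mul (M : ℝ))
    simpa [U] using this
  refine squeeze_zero' (Eventually.of_forall fun n => ENNReal.toReal_nonneg) ?_ hU
  have hsmall : ∀ᶠ n : ℕ in atTop, (Real.log (n : ℝ))⁻¹ ≤ Real.exp (-2) * (ρ * ε / M) / 12 :=
    (tendsto_inv_atTop_zero.comp hlog).eventually_le_const (by positivity)
  have hpow : ∀ᶠ n : ℕ in atTop, 2 * (1 - ρ) ^ (t n - 2 + 1) ≤ ε := by
    have h1 : Tendsto (fun n => t n - 2 + 1) atTop atTop :=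
      tendsto_atTop_mono (fun n => Nat.le_succ (t n - 2)) ((tendsto_sub_atTop_nat 2).comp ht)
    have h2 := ((tendsto_pow_atTop_nhds_zero_of_lt_one (r := 1 - ρ) (by linarith)
      (by linarith)).comp h1).const_mul 2
    rw [mul_zero] at h2
    exact h2.eventually_le_const hε
  filter_upwards [hp, hlog.eventually_ge_atTop 1, ht.eventually_ge_atTop 2, ht'.bound one_pos,
    hsmall, hpow, eventually_ge_atTop 1] with n hpn hlogn htn htb hδ hpw hn
  have hn' : (0 : ℝ) < n := by exact_mod_cast hn
  have hL0 : 0 < Real.log n := by linarith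
  have hnp : n * (p n : ℝ) = lam n * Real.log n := by rw [hpn]; field_simp
  have hlamn := (hlam n).1
  have hnp1 : a * Real.log n ≤ n * p n := by rw [hnp]; gcongr
  have hnp2 : Real.log n ≤ n * p n := le_trans (le_mul_of_one_le_left hL0.le ha.le) hnp1
  have hp0 : 0 < (p n : ℝ) := by
    rw [hpn]
    have : 0 < lam n := by linarith
    positivity
  have hmn : (2 : ℝ) ≤ m n := by exact_mod_cast hm n
  have hmM : (m n : ℝ) ≤ M := by exact_mod_cast hM n
  set Λ := Real.log (n : ℝ) with hΛ
  have htsq : (t n : ℝ) ^ 2 / n ≤ (Λ ^ 4)⁻¹ := by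
    have h1 : (t n : ℝ) ≤ Real.sqrt n / Λ ^ 2 := by
      have h2 : ‖(t n : ℝ)‖ = t n := Real.norm_of_nonneg (Nat.cast_nonneg _)
      have h3 : ‖Real.sqrt n / Λ ^ 2‖ = Real.sqrt n / Λ ^ 2 :=
        Real.norm_of_nonneg (by positivity)
      rwa [h2, h3, one_mul] at htb
    calc (t n : ℝ) ^ 2 / n ≤ (Real.sqrt n / Λ ^ 2) ^ 2 / n := by gcongr
      _ = (Λ ^ 4)⁻¹ := by
        rw [div_pow, Real.sq_sqrt hn'.le]
        field_simp
  have hL4 : (Λ ^ 4)⁻¹ ≤ Λ⁻¹ := by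
    apply inv_anti₀ hL0
    calc Λ = Λ ^ 1 := (pow_one _).symm
      _ ≤ Λ ^ 4 := pow_le_pow_right₀ hlogn (by norm_num)
  have hninv : 1 / (n : ℝ) ≤ Λ⁻¹ := by
    rw [one_div]
    exact inv_anti₀ hL0 ((Real.log_le_sub_one_of_pos hn').trans (by linarith))
  have herr : DBM.pairErr n (p n) (t n - 2) ≤ 15 * Λ⁻¹ :=
    DBM.pairErr_le hn htn (htsq.trans hL4) hninv (by
      rw [one_div]
      exact inv_anti₀ hL0 hnp2)
  -- With at least `log n` moments and a ratio at most `exp (-2)`, the moment bound is at most `n ^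
  -- (-2)`, leaving `1 / n` after the union over vertices.
  set k := ⌈Λ⌉₊ with hk
  have hk1 : Λ ≤ k := Nat.le_ceil _
  have hk2 : (k : ℝ) < Λ + 1 := Nat.ceil_lt_add_one hL0.le
  have hhit : 4 * ((k : ℝ) + 1) * ((t n : ℝ) ^ 2 / n) ≤ 12 * Λ⁻¹ := by
    calc 4 * ((k : ℝ) + 1) * ((t n : ℝ) ^ 2 / n) ≤ 4 * (3 * Λ) * (Λ ^ 4)⁻¹ := by
          gcongr
          linarith
      _ = 12 * (Λ ^ 3)⁻¹ := by field_simp; norm_num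
      _ ≤ 12 * Λ⁻¹ := by
          refine mul_le_mul_of_nonneg_left (inv_anti₀ hL0 ?_) (by norm_num)
          calc Λ = Λ ^ 1 := (pow_one _).symm
            _ ≤ Λ ^ 3 := pow_le_pow_right₀ hlogn (by norm_num)
  -- The case may change with `n`; the threshold `ρ` is fixed, so the mixing rate `1 - ρ` is
  -- uniform.
  have hcase : (α n : ℝ) ≤ ρ ∨ (m n = 2 ∧ 1 - (α n : ℝ) ≤ ρ) ∨
      2 * |DBM.eig (m n) (α n)| ^ (t n - 2 + 1) ≤ ε := by
    by_cases h1 : (α n : ℝ) ≤ ρ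
    · exact Or.inl h1
    by_cases h2 : m n = 2 ∧ 1 - (α n : ℝ) ≤ ρ
    · exact Or.inr (Or.inl h2)
    refine Or.inr (Or.inr (le_trans ?_ hpw))
    have h3 := DBM.abs_eig_le (hm n) hρ1 (not_le.1 h1) fun h => not_le.1 fun h' => h2 ⟨h, h'⟩
    gcongr
  have main := DBM.prob_maxDev_le (hm n) hn hnp2 hp0 (t n - 2) k hε hρ0 hρ2 hθ
    ((DBM.hitErr_le hn htn).trans hhit) hcase
  have ht2 : t n - 2 + 2 = t n := by omega
  rw [ht2] at main
  have hstep : (DBM.law (m n) n (p n) (α n) {ω | ε₀ < DBM.maxDev (α n : ℝ) (t n) ω}).toReal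
      ≤ FinProd.prob (DBM.edgeWeight (m n) n (p n) (α n))
        {ω | m n * (4 * ε) < DBM.maxDev (α n : ℝ) (t n) ω} := by
    refine (DBM.law_real_eq_prob (hm n) _).le.trans
      (FinProd.prob_mono (DBM.isLaw_edgeWeight (hm n)) fun ω hω => ?_)
    refine lt_of_le_of_lt ?_ (show ε₀ < _ from hω)
    rw [← hεM]
    gcongr
  refine hstep.trans (main.trans (add_le_add (add_le_add ?_ ?_) ?_))
  · have := DBM.pairErr_nonneg n hp0.le (t n - 2)
    gcongr
  · have h1 : 12 * Λ⁻¹ / (ρ * ε / m n) ≤ Real.exp (-2) := by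
      rw [div_le_iff₀ (by positivity)]
      have h2 : ρ * ε / M ≤ ρ * ε / m n := by gcongr
      have h3 := mul_le_mul_of_nonneg_left h2 (Real.exp_pos (-2)).le
      linarith
    have h2 : (12 * Λ⁻¹ / (ρ * ε / m n)) ^ k ≤ Real.exp (-(2 * Λ)) := by
      calc _ ≤ Real.exp (-2) ^ k := by gcongr
        _ = Real.exp (-(2 * k)) := by rw [← Real.exp_nat_mul]; ring_nf
        _ ≤ _ := by gcongr
    have h3 : (n : ℝ) * Real.exp (-(2 * Λ)) = (n : ℝ)⁻¹ := by
      have h4 : Real.exp (-Λ) = (n : ℝ)⁻¹ := by rw [Real.exp_neg, hΛ, Real.exp_log hn']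
      have h5 : Real.exp (-(2 * Λ)) = Real.exp (-Λ) * Real.exp (-Λ) := by
        rw [← Real.exp_add]; ring_nf
      rw [h5, h4]
      field_simp
    calc _ ≤ (M : ℝ) * n * Real.exp (-(2 * Λ)) := by gcongr
      _ = M * (n : ℝ)⁻¹ := by rw [mul_assoc, h3]
  · have hc : 0 ≤ 1 - Real.exp (-θ) - 3 * ρ * Real.exp (θ / ε) := by
      have : 0 < a * (1 - Real.exp (-θ) - 3 * ρ * Real.exp (θ / ε)) := by linarith
      exact (pos_of_mul_pos_right this (by linarith)).le
    have h1 : (1 + γ) * Λ ≤ n * p n * (1 - Real.exp (-θ) - 3 * ρ * Real.exp (θ / ε)) := by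
      have h2 := mul_le_mul_of_nonneg_right hnp1 hc
      have h3 := mul_le_mul_of_nonneg_right hγa hL0.le
      linarith
    have h4 : (n : ℝ) * Real.exp (-((1 + γ) * Λ)) = Real.exp (-(γ * Λ)) := by
      have h5 : (n : ℝ) = Real.exp Λ := by rw [hΛ, Real.exp_log hn']
      rw [h5, ← Real.exp_add]
      ring_nf
    calc _ ≤ (M : ℝ) * n * Real.exp (-((1 + γ) * Λ)) := by gcongr
      _ = _ := by rw [mul_assoc, h4]
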